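/- **Setting.** Let $d\in\mathbb N$. For $j\ge 1$ let $R_j$ be a $d\times d$ integer matrix that is expanding (all its complex eigenvalues have modulus $>1$), and let $B_j,L_j\subset\mathbb Z^d$ be finite sets with $0\in B_j\cap L_j$. For $\lambda\in\mathbb Z^d$ put $\mathbf e_{R_j,\lambda}=\frac1{\sqrt{\#B_j}}\left(e^{2\pi i\langle R_j^{-1}b,\lambda\rangle}\right)_{b\in B_j}\in\mathbb C^{\#B_j}$. Let $0<C_j\le D_j<\infty$ be such that $\prod_{j\ge1}C_j$ and $\prod_{j\ge1}D_j$ converge (as limits of partial products) with $\prod_{j\ge1}C_j>0$ and $\prod_{j\ge1}D_j<\infty$. Suppose that $\{(R_j,B_j,L_j)\}_{j\ge1}$ is a *frame tower* with bounds $C_j,D_j$, that is, for every $j$, $$C_j\|\mathbf x\|^2\le\sum_{\lambda\in L_j}|\langle\mathbf x,\mathbf e_{R_j,\lambda}\rangle|^2\le D_j\|\mathbf x\|^2\qquad\text{for all }\mathbf x\in\mathbb C^{\#B_j}.$$ Put $\mathbf R_n=R_n\cdots R_1$ and, for a finite set $A\subset\mathbb R^d$, $\delta_A=\frac1{\#A}\sum_{a\in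 A}\delta_a$. Suppose that $\delta_{\mathbf R_1^{-1}B_1}*\cdots*\delta_{\mathbf R_m^{-1}B_m}$ converges weakly, as $m\to\infty$, to a Borel probability measure $\mu$ on $\mathbb R^d$. For $n\ge0$ let $\mu_{>n}$ be the weak limit of $\delta_{\mathbf R_{n+1}^{-1}B_{n+1}}*\cdots*\delta_{\mathbf R_m^{-1}B_m}$ as $m\to\infty$, let $\mathbf B_n=\mathbf R_n\{\sum_{k=1}^n\mathbf R_k^{-1}b_k:b_k\in B_k\}$, and let $K_n$ be the set of the sums of the convergent series $\sum_{k>n}\mathbf R_k^{-1}b_k$ with $b_k\in B_k$. Suppose that there is *no overlap*: for all $n$ and all $\mathbf b\ne\mathbf b'$ in $\mathbf B_n$, $$\mu\big((\mathbf R_n^{-1}\mathbf b+K_n)\cap(\mathbf R_n^{-1}\mathbf b'+K_n)\big)=0 .$$ Let $\Lambda_n=\{\ell_1+R_1^{T}\ell_2+\dots+R_1^{T}\cdots R_{n-1}^{T}\ell_n:\ \ell_j\in L_j\}$ and $\Lambda=\bigcup_{n\ge1}\Lambda_n$. With $\widehat\nu(y)=\int e^{-2\pi i\langle y,x\rangle}\,d\nu(x)$,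 suppose that $$\delta(\Lambda)=\inf_{n\ge1}\ \inf_{\lambda\in\Lambda_n}|\widehat{\mu_{>n}}(\lambda)|^2>0 .$$ For $\Lambda'\subseteq\Lambda$ let $E(\Lambda')$ be the family $\left(e^{2\pi i\langle\lambda,x\rangle}\right)_{\lambda\in\Lambda'}$ in $L^2(\mu)$. A family $(f_k)$ in a Hilbert space is a *frame* if there are $C,D>0$ with $C\|x\|^2\le\sum_k|\langle x,f_k\rangle|^2\le D\|x\|^2$ for all $x$; it is a *Riesz sequence* if there are $C,D>0$ with $C\sum|a_k|^2\le\|\sum a_kf_k\|^2\le D\sum|a_k|^2$ for all finitely supported scalars $(a_k)$; it is a *Riesz basis* if it is both. **Theorem.** (i) If $\#B_j=\#L_j$ for every $j$, then $E(\Lambda)$ is a Riesz basis for $L^2(\mu)$. (ii) If $\#B_j<\#L_j$ for some $j$, then $E(\Lambda)$ is a frame for $L^2(\mu)$. If, moreover, $\Lambda$ is infinite and for every $n$ each element of $\Lambda_n$ has only one representation $\ell_1+R_1^{T}\ell_2+\dots+R_1^{T}\cdots R_{n-1}^{T}\ell_n$ with $\ell_j\in L_j$, then the frame has infinite redundancy: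 there is an infinite subset $\Lambda_0\subseteq\Lambda$ such that $E(\Lambda\setminus\Lambda_0)$ is still a frame for $L^2(\mu)$. -/

import Mathlib

open MeasureTheory Filter Topology
open scoped NNReal

noncomputable section

namespace FrameTower

/-! ### Frames and Riesz bases in a complex Hilbert space -/

section Hilbert

variable {ι H : Type*} [NormedAddCommGroup H] [InnerProductSpace ℂ H]

/-- A family `f` is a frame: `C ‖x‖² ≤ ∑ |⟨x, f k⟩|² ≤ D ‖x‖²` for some `C, D > 0`. -/
def IsFrame (f : ι → H) : Prop :=
  ∃ C D : ℝ, 0 < C ∧ 0 < D ∧ ∀ x : H,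
    Summable (fun k => ‖inner ℂ x (f k)‖ ^ 2) ∧
    C * ‖x‖ ^ 2 ≤ ∑' k, ‖inner ℂ x (f k)‖ ^ 2 ∧
    ∑' k, ‖inner ℂ x (f k)‖ ^ 2 ≤ D * ‖x‖ ^ 2

/-- A family `f` is a Riesz sequence: for some `C, D > 0` and all finitely supported scalars `a`,
`C ∑ |a k|² ≤ ‖∑ a k • f k‖² ≤ D ∑ |a k|²`. -/
def IsRieszSequence (f : ι → H) : Prop :=
  ∃ C D : ℝ, 0 < C ∧ 0 < D ∧ ∀ a : ι →₀ ℂ,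
    C * ∑ k ∈ a.support, ‖a k‖ ^ 2 ≤ ‖∑ k ∈ a.support, a k • f k‖ ^ 2 ∧
    ‖∑ k ∈ a.support, a k • f k‖ ^ 2 ≤ D * ∑ k ∈ a.support, ‖a k‖ ^ 2

/-- A Riesz basis is a family that is both a frame and a Riesz sequence. -/
def IsRieszBasis (f : ι → H) : Prop :=
  IsFrame f ∧ IsRieszSequence f

end Hilbert

/-! ### Integer matrices, frame triples, frame towers

The levels `j = 1, 2, …` are indexed from `0`: `R j`, `B j`, `L j` is the level `j + 1`. -/

variable {d : ℕ}

/-- An integer vector as a point of Euclidean space. -/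
def toReal (v : Fin d → ℤ) : EuclideanSpace ℝ (Fin d) :=
  WithLp.toLp 2 (fun i => (v i : ℝ))

/-- `A⁻¹ v` in Euclidean space, for an integer matrix `A` and an integer vector `v`. -/
def invApply (A : Matrix (Fin d) (Fin d) ℤ) (v : Fin d → ℤ) : EuclideanSpace ℝ (Fin d) :=
  WithLp.toLp 2 (Matrix.mulVec (A.map (Int.cast : ℤ → ℝ))⁻¹ (fun i => (v i : ℝ)))

/-- All complex eigenvalues of `R` have modulus strictly greater than one. -/
def IsExpanding (R : Matrix (Fin d) (Fin d) ℤ) : Prop :=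
  ∀ z ∈ spectrum ℂ (R.map (Int.cast : ℤ → ℂ)), 1 < ‖z‖

/-- The vector `e_{R,l} = (#B)^{-1/2} (exp (2 π i ⟨R⁻¹ b, l⟩))_{b ∈ B}`. -/
def expVector (R : Matrix (Fin d) (Fin d) ℤ) (B : Finset (Fin d → ℤ)) (l : Fin d → ℤ) :
    EuclideanSpace ℂ B :=
  WithLp.toLp 2 (fun b => ((1 / Real.sqrt (B.card : ℝ) : ℝ) : ℂ) *
    Complex.exp (2 * Real.pi * Complex.I * (inner ℝ (invApply R b.1) (toReal l) : ℝ)))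

/-- `(R, B, L)` is a frame triple with bounds `C ≤ D`. -/
structure IsFrameTriple (R : Matrix (Fin d) (Fin d) ℤ) (B L : Finset (Fin d → ℤ))
    (C D : ℝ) : Prop where
  expanding : IsExpanding R
  zero_mem_digits : (0 : Fin d → ℤ) ∈ B
  zero_mem_freqs : (0 : Fin d → ℤ) ∈ L
  le : C ≤ D
  lower : ∀ x : EuclideanSpace ℂ B, C * ‖x‖ ^ 2 ≤ ∑ l ∈ L, ‖inner ℂ x (expVector R B l)‖ ^ 2
  upper : ∀ x : EuclideanSpace ℂ B, ∑ l ∈ L, ‖inner ℂ x (expVector R B l)‖ ^ 2 ≤ D * ‖x‖ ^ 2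

/-- A frame tower with respect to the bounds `C j`, `D j`; the infinite products
`∏ C j > 0` and `∏ D j < ∞` are limits of partial products. -/
structure IsFrameTower (R : ℕ → Matrix (Fin d) (Fin d) ℤ) (B L : ℕ → Finset (Fin d → ℤ))
    (C D : ℕ → ℝ) : Prop where
  pos : ∀ j, 0 < C j
  prod_lower : ∃ c : ℝ, 0 < c ∧ Tendsto (fun n => ∏ j ∈ Finset.range n, C j) atTop (𝓝 c)
  prod_upper : ∃ c : ℝ, Tendsto (fun n => ∏ j ∈ Finset.range n, D j) atTop (𝓝 c)
  triple : ∀ j, IsFrameTriple (R j) (B j) (L j) (C j) (D j)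

/-- `𝐑_n = R_n ⋯ R_1`, a product of the first `n` matrices. -/
def prodR (R : ℕ → Matrix (Fin d) (Fin d) ℤ) : ℕ → Matrix (Fin d) (Fin d) ℤ
  | 0 => 1
  | n + 1 => R n * prodR R n

/-- The element `l_1 + R_1ᵀ l_2 + ⋯ + R_1ᵀ ⋯ R_{n-1}ᵀ l_n` of `Λ_n`. -/
def freqSum (R : ℕ → Matrix (Fin d) (Fin d) ℤ) (l : ℕ → Fin d → ℤ) (n : ℕ) : Fin d → ℤ :=
  ∑ j ∈ Finset.range n, Matrix.mulVec (prodR R j).transpose (l j)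

/-- `Λ_n = L_1 + R_1ᵀ L_2 + ⋯ + R_1ᵀ ⋯ R_{n-1}ᵀ L_n`. -/
def freqLevel (R : ℕ → Matrix (Fin d) (Fin d) ℤ) (L : ℕ → Finset (Fin d → ℤ)) (n : ℕ) :
    Set (Fin d → ℤ) :=
  {v | ∃ l : ℕ → Fin d → ℤ, (∀ j, l j ∈ L j) ∧ v = freqSum R l n}

/-- `Λ = ⋃_{n ≥ 1} Λ_n`. -/
def freqSet (R : ℕ → Matrix (Fin d) (Fin d) ℤ) (L : ℕ → Finset (Fin d → ℤ)) :
    Set (Fin d → ℤ) :=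
  ⋃ n ≥ 1, freqLevel R L n

/-- Every element of every `Λ_n` has only one representation
`l_1 + R_1ᵀ l_2 + ⋯ + R_1ᵀ ⋯ R_{n-1}ᵀ l_n` with `l_j ∈ L_j`. -/
def UniqueFreqSums (R : ℕ → Matrix (Fin d) (Fin d) ℤ) (L : ℕ → Finset (Fin d → ℤ)) : Prop :=
  ∀ n, ∀ l l' : ℕ → Fin d → ℤ, (∀ j, l j ∈ L j) → (∀ j, l' j ∈ L j) →
    freqSum R l n = freqSum R l' n → ∀ j < n, l j = l' j

/-! ### The infinite convolution -/

/-- The level-`j` factor: mass `1 / #B_j` at each point `𝐑_j⁻¹ b`, `b ∈ B_j`. -/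
def digitMeasure (R : ℕ → Matrix (Fin d) (Fin d) ℤ) (B : ℕ → Finset (Fin d → ℤ)) (j : ℕ) :
    Measure (EuclideanSpace ℝ (Fin d)) :=
  ((B j).card : ℝ≥0)⁻¹ • ∑ b ∈ B j, Measure.dirac (invApply (prodR R (j + 1)) b)

instance (R : ℕ → Matrix (Fin d) (Fin d) ℤ) (B : ℕ → Finset (Fin d → ℤ)) (j : ℕ) :
    IsFiniteMeasure (digitMeasure R B j) := by
  unfold digitMeasure; infer_instance

/-- The convolution of the `m` factors that follow the first `n` ones. -/
def convMeasure (R : ℕ → Matrix (Fin d) (Fin d) ℤ) (B : ℕ → Finset (Fin d → ℤ)) (n : ℕ) :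
    ℕ → Measure (EuclideanSpace ℝ (Fin d))
  | 0 => Measure.dirac 0
  | m + 1 => (convMeasure R B n m).conv (digitMeasure R B (n + m))

instance (R : ℕ → Matrix (Fin d) (Fin d) ℤ) (B : ℕ → Finset (Fin d → ℤ)) (n m : ℕ) :
    IsFiniteMeasure (convMeasure R B n m) := by
  induction m with
  | zero => unfold convMeasure; infer_instance
  | succ m ih => unfold convMeasure; infer_instance

/-- `convMeasure` as a point of the space of finite measures with the weak topology. -/
def convFinite (R : ℕ → Matrix (Fin d) (Fin d) ℤ) (B : ℕ → Finset (Fin d → ℤ)) (n m : ℕ) :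
    FiniteMeasure (EuclideanSpace ℝ (Fin d)) :=
  ⟨convMeasure R B n m, inferInstance⟩

/-- `μ = μ({R_j, B_j})`: the finite convolutions converge weakly to the probability
measure `μ`. -/
def IsInfiniteConvolution (R : ℕ → Matrix (Fin d) (Fin d) ℤ) (B : ℕ → Finset (Fin d → ℤ))
    (μ : ProbabilityMeasure (EuclideanSpace ℝ (Fin d))) : Prop :=
  Tendsto (fun m => convFinite R B 0 m) atTop (𝓝 μ.toFiniteMeasure)

/-- The tail `μ_{>n}`: the weak limit of the convolutions of the factors after the first `n`
(it exists whenever the whole infinite convolution converges and all `B_j` contain `0`). -/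
def tailMeasure (R : ℕ → Matrix (Fin d) (Fin d) ℤ) (B : ℕ → Finset (Fin d → ℤ)) (n : ℕ) :
    FiniteMeasure (EuclideanSpace ℝ (Fin d)) :=
  limUnder atTop (fun m => convFinite R B n m)

/-- The set `𝐑_n⁻¹ 𝐁_n` of the sums `∑_{k ≤ n} 𝐑_k⁻¹ b_k`, `b_k ∈ B_k`. It is the image
of `𝐁_n` under the injective map `b ↦ 𝐑_n⁻¹ b`. -/
def headPoints (R : ℕ → Matrix (Fin d) (Fin d) ℤ) (B : ℕ → Finset (Fin d → ℤ)) (n : ℕ) :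
    Set (EuclideanSpace ℝ (Fin d)) :=
  {x | ∃ b : ℕ → Fin d → ℤ, (∀ k, b k ∈ B k) ∧
    x = ∑ k ∈ Finset.range n, invApply (prodR R (k + 1)) (b k)}

/-- `K_n`: the set of the sums of the (convergent) series `∑_{k > n} 𝐑_k⁻¹ b_k`, `b_k ∈ B_k`. -/
def tailPoints (R : ℕ → Matrix (Fin d) (Fin d) ℤ) (B : ℕ → Finset (Fin d → ℤ)) (n : ℕ) :
    Set (EuclideanSpace ℝ (Fin d)) :=
  {x | ∃ b : ℕ → Fin d → ℤ, (∀ k, b k ∈ B k) ∧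
    Tendsto (fun m => ∑ k ∈ Finset.Ico n m, invApply (prodR R (k + 1)) (b k)) atTop (𝓝 x)}

/-- The no-overlap condition: for each `n` the sets `p + K_n`, `p ∈ 𝐑_n⁻¹ 𝐁_n`, have
pairwise intersections of `μ`-measure zero. -/
def NoOverlap (R : ℕ → Matrix (Fin d) (Fin d) ℤ) (B : ℕ → Finset (Fin d → ℤ))
    (μ : ProbabilityMeasure (EuclideanSpace ℝ (Fin d))) : Prop :=
  ∀ n, ∀ p ∈ headPoints R B n, ∀ q ∈ headPoints R B n, p ≠ q →
    (μ : Measure (EuclideanSpace ℝ (Fin d)))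
      (((fun x => p + x) '' tailPoints R B n) ∩ ((fun x => q + x) '' tailPoints R B n)) = 0

/-- The Fourier transform `∫ exp (-2 π i ⟨y, x⟩) dμ(x)`. -/
def fourier (μ : Measure (EuclideanSpace ℝ (Fin d))) (y : EuclideanSpace ℝ (Fin d)) : ℂ :=
  ∫ x, Complex.exp (-(2 * Real.pi * Complex.I * (inner ℝ y x : ℝ))) ∂μ

/-- `δ(Λ) = inf_{n ≥ 1} inf_{λ ∈ Λ_n} |μ_{>n}^(λ)|²`. -/
def tailBound (R : ℕ → Matrix (Fin d) (Fin d) ℤ) (B L : ℕ → Finset (Fin d → ℤ)) : ℝ :=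
  sInf {r : ℝ | ∃ n ≥ 1, ∃ l ∈ freqLevel R L n,
    r = ‖fourier (tailMeasure R B n : Measure (EuclideanSpace ℝ (Fin d))) (toReal l)‖ ^ 2}

/-! ### Exponentials in `L²(μ)` -/

/-- The exponential `x ↦ exp (2 π i ⟨l, x⟩)`. -/
def expFun (l : Fin d → ℤ) (x : EuclideanSpace ℝ (Fin d)) : ℂ :=
  Complex.exp (2 * Real.pi * Complex.I * (inner ℝ (toReal l) x : ℝ))

theorem memLp_expFun (μ : Measure (EuclideanSpace ℝ (Fin d))) [IsFiniteMeasure μ]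
    (l : Fin d → ℤ) : MemLp (expFun l) 2 μ := by
  refine MemLp.of_bound (C := 1) ?_ (Eventually.of_forall fun x => ?_)
  · apply Continuous.aestronglyMeasurable
    unfold expFun
    fun_prop
  · have h : (2 * Real.pi * Complex.I * (inner ℝ (toReal l) x : ℝ) : ℂ)
        = ((2 * Real.pi * inner ℝ (toReal l) x : ℝ) : ℂ) * Complex.I := by
      push_cast; ring
    rw [expFun, h, Complex.norm_exp_ofReal_mul_I]

/-- The family `E(Λ) = {exp (2 π i ⟨l, ·⟩) : l ∈ Λ}` in `L²(μ)`, indexed by `Λ`. -/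
def expFamily (μ : ProbabilityMeasure (EuclideanSpace ℝ (Fin d))) (S : Set (Fin d → ℤ)) :
    S → Lp ℂ 2 (μ : Measure (EuclideanSpace ℝ (Fin d))) :=
  fun l => (memLp_expFun (μ : Measure (EuclideanSpace ℝ (Fin d))) l.1).toLp (expFun l.1)

end FrameTower

end

namespace FrameTower

variable {d : ℕ}

/-! ### The exponentials -/

/-! Write μ_n for the convolution of the first n factors and e_v for the exponential with frequency
v. Everything is first proved exactly on the finitely supported μ_n and then carried to μ by weak
convergence.

On μ_n the levels multiply. The matrix `prodR R n` maps the support of μ_n into ℤ^d, so passing from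
n to n + 1 factors e_v into an entry of the next level's matrix, a unimodular twist and an
exponential on μ_n (`expFun_split`). Inductively, the coefficients of any function over Λ_n satisfy
the frame inequality in L²(μ_n) with bounds ∏ C_j and ∏ D_j (`analysis_lower`, `analysis_upper`),
and trigonometric polynomials satisfy the dual bounds (`synthesis_upper`, and `synthesis_lower` if
#B_j = #L_j, since a frame with as many vectors as the dimension is a Riesz basis). Coinciding sums
are counted with multiplicity; the upper bound caps the multiplicities (`count_le`), so passing to
distinct frequencies costs a constant.

The squared modulus of a trigonometric polynomial is bounded and continuous, so the synthesis bounds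
pass to μ. This gives the Riesz sequence property and, by duality, the upper frame bound.

For the lower frame bound, write μ = μ_n * ν_n, where ν_n is the tail and tends to the unit mass at
0 (`exists_tail`, `tendsto_dirac`). Let f be continuous with compact support. Its v-th coefficient
over μ is close to its coefficient over μ_n times the Fourier transform of ν_n at v. The error,
summed over Λ_n, is controlled by the upper bound on μ_n applied to f minus its translates, averaged
over ν_n (`sum_sub_le`). The main term is bounded below by δ(Λ) and the lower bound on μ_n
(`le_sum_sampled`). Letting n tend to infinity and using density gives the frame.

For redundancy, a level with #B_J < #L_J has a nonzero frequency whose removal leaves a frame triple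
(`exists_erase`). The smaller tower satisfies the same hypotheses, hence yields a frame, and unique
representation makes the set of lost frequencies infinite (`infinite_freqSet_diff`). -/

theorem toReal_add (v w : Fin d → ℤ) : toReal (v + w) = toReal v + toReal w := by
  ext i; simp [toReal]

theorem toReal_zero : toReal (0 : Fin d → ℤ) = 0 := by
  ext i; simp [toReal]

theorem expFun_add_left (l m : Fin d → ℤ) (x : EuclideanSpace ℝ (Fin d)) :
    expFun (l + m) x = expFun l x * expFun m x := by
  rw [expFun, expFun, expFun, ← Complex.exp_add, toReal_add, inner_add_left]
  push_cast; ring_nf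

theorem expFun_add_right (l : Fin d → ℤ) (x y : EuclideanSpace ℝ (Fin d)) :
    expFun l (x + y) = expFun l x * expFun l y := by
  rw [expFun, expFun, expFun, ← Complex.exp_add, inner_add_right]
  push_cast; ring_nf

@[simp]
theorem norm_expFun (l : Fin d → ℤ) (x : EuclideanSpace ℝ (Fin d)) : ‖expFun l x‖ = 1 := by
  have h : (2 * Real.pi * Complex.I * (inner ℝ (toReal l) x : ℝ) : ℂ)
      = ((2 * Real.pi * inner ℝ (toReal l) x : ℝ) : ℂ) * Complex.I := by
    push_cast; ring
  rw [expFun, h, Complex.norm_exp_ofReal_mul_I]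

theorem continuous_expFun (l : Fin d → ℤ) : Continuous (expFun l) := by
  unfold expFun; fun_prop

theorem expFun_zero_left (x : EuclideanSpace ℝ (Fin d)) : expFun 0 x = 1 := by
  simp [expFun, toReal_zero]

/-- Integer frequencies are constant on integer points. -/
theorem expFun_toReal (l v : Fin d → ℤ) : expFun l (toReal v) = 1 := by
  have h : inner ℝ (toReal l) (toReal v) = ((∑ i, v i * l i : ℤ) : ℝ) := by
    simp [toReal, PiLp.inner_apply]
  rw [expFun, h, Complex.exp_eq_one_iff]
  exact ⟨∑ i, v i * l i, by push_cast; ring⟩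

theorem fourier_eq_integral_expFun (ν : Measure (EuclideanSpace ℝ (Fin d))) (l : Fin d → ℤ) :
    fourier ν (toReal l) = ∫ x, star (expFun l x) ∂ν := by
  rw [fourier]
  congr 1; ext x
  rw [expFun, Complex.star_def, ← Complex.exp_conj]
  simp [Complex.conj_ofNat]

/-! ### Matrices acting on Euclidean space -/

/-- An integer matrix acting on Euclidean space. -/
noncomputable def actReal (A : Matrix (Fin d) (Fin d) ℤ) (x : EuclideanSpace ℝ (Fin d)) :
    EuclideanSpace ℝ (Fin d) :=
  WithLp.toLp 2 (Matrix.mulVec (A.map (Int.cast : ℤ → ℝ)) x.ofLp)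

theorem actReal_add (A : Matrix (Fin d) (Fin d) ℤ) (x y : EuclideanSpace ℝ (Fin d)) :
    actReal A (x + y) = actReal A x + actReal A y := by
  ext i; simp [actReal, Matrix.mulVec_add]

theorem actReal_toReal (A : Matrix (Fin d) (Fin d) ℤ) (v : Fin d → ℤ) :
    actReal A (toReal v) = toReal (A.mulVec v) := by
  ext i; simp [actReal, toReal, Matrix.mulVec, dotProduct]

theorem actReal_mul (A A' : Matrix (Fin d) (Fin d) ℤ) (x : EuclideanSpace ℝ (Fin d)) :
    actReal (A * A') x = actReal A (actReal A' x) := by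
  ext i
  have : (A * A').map (Int.cast : ℤ → ℝ) = A.map Int.cast * A'.map Int.cast :=
    Matrix.map_mul (f := Int.castRingHom ℝ)
  simp only [actReal, this, Matrix.mulVec_mulVec]

theorem actReal_one (x : EuclideanSpace ℝ (Fin d)) : actReal 1 x = x := by
  ext i; simp [actReal]

theorem inner_toReal_transpose (A : Matrix (Fin d) (Fin d) ℤ) (l : Fin d → ℤ)
    (x : EuclideanSpace ℝ (Fin d)) :
    inner ℝ (toReal (A.transpose.mulVec l)) x = inner ℝ (toReal l) (actReal A x) := by
  simp only [toReal, actReal, PiLp.inner_apply, Matrix.mulVec, dotProduct, Matrix.transpose_apply,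
    Matrix.map_apply, RCLike.inner_apply, conj_trivial]
  push_cast
  simp only [Finset.mul_sum, Finset.sum_mul]
  rw [Finset.sum_comm]
  refine Finset.sum_congr rfl fun i _ => Finset.sum_congr rfl fun j _ => by ring

theorem expFun_transpose (A : Matrix (Fin d) (Fin d) ℤ) (l : Fin d → ℤ)
    (x : EuclideanSpace ℝ (Fin d)) :
    expFun (A.transpose.mulVec l) x = expFun l (actReal A x) := by
  rw [expFun, inner_toReal_transpose, expFun]

/-- Otherwise 0 would be an eigenvalue. Invertibility is what the later arguments take from
expansion. -/
theorem IsExpanding.det_ne_zero {A : Matrix (Fin d) (Fin d) ℤ} (h : IsExpanding A) :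
    A.det ≠ 0 := by
  intro h0
  have h1 : (0 : ℂ) ∈ spectrum ℂ (A.map (Int.cast : ℤ → ℂ)) := by
    rw [spectrum.zero_mem_iff, Matrix.isUnit_iff_isUnit_det]
    have : (A.map (Int.cast : ℤ → ℂ)).det = ((A.det : ℤ) : ℂ) :=
      ((Int.castRingHom ℂ).map_det A).symm
    rw [this, h0]; simp
  have := h 0 h1
  simp at this
  linarith

theorem isUnit_det_map {A : Matrix (Fin d) (Fin d) ℤ} (h : A.det ≠ 0) :
    IsUnit (A.map (Int.cast : ℤ → ℝ)).det := by
  have : (A.map (Int.cast : ℤ → ℝ)).det = ((A.det : ℤ) : ℝ) :=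
    ((Int.castRingHom ℝ).map_det A).symm
  rw [this, isUnit_iff_ne_zero]
  exact_mod_cast h

theorem actReal_invApply {A : Matrix (Fin d) (Fin d) ℤ} (h : A.det ≠ 0) (v : Fin d → ℤ) :
    actReal A (invApply A v) = toReal v := by
  ext i
  simp [actReal, invApply, toReal, Matrix.mulVec_mulVec, Matrix.mul_nonsing_inv _ (isUnit_det_map h)]

theorem invApply_zero (A : Matrix (Fin d) (Fin d) ℤ) : invApply A 0 = 0 := by
  ext i; simp [invApply, Matrix.mulVec, dotProduct]

theorem actReal_injective {A : Matrix (Fin d) (Fin d) ℤ} (h : A.det ≠ 0) :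
    Function.Injective (actReal A) := by
  intro x y hxy
  have hu := isUnit_det_map h
  have h2 : Matrix.mulVec (A.map (Int.cast : ℤ → ℝ)) x.ofLp
      = Matrix.mulVec (A.map (Int.cast : ℤ → ℝ)) y.ofLp := congrArg WithLp.ofLp hxy
  have h3 := congrArg (Matrix.mulVec (A.map (Int.cast : ℤ → ℝ))⁻¹) h2
  rw [Matrix.mulVec_mulVec, Matrix.mulVec_mulVec, Matrix.nonsing_inv_mul _ hu, Matrix.one_mulVec,
    Matrix.one_mulVec] at h3
  exact congrArg (WithLp.toLp 2) h3

theorem actReal_invApply_mul {A A' : Matrix (Fin d) (Fin d) ℤ} (h : A.det ≠ 0) (h' : A'.det ≠ 0)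
    (v : Fin d → ℤ) : actReal A' (invApply (A * A') v) = invApply A v := by
  apply actReal_injective h
  rw [← actReal_mul, actReal_invApply (by rw [Matrix.det_mul]; exact mul_ne_zero h h'),
    actReal_invApply h]

/-! ### One level of a frame tower -/

section Level

variable {R : Matrix (Fin d) (Fin d) ℤ} {B L : Finset (Fin d → ℤ)} {C D : ℝ}

theorem IsFrameTriple.card_pos (h : IsFrameTriple R B L C D) : 0 < (B.card : ℝ) := by
  exact_mod_cast Finset.card_pos.2 ⟨0, h.zero_mem_digits⟩

theorem expVector_apply (l : Fin d → ℤ) (b : B) :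
    expVector R B l b = ((1 / Real.sqrt (B.card : ℝ) : ℝ) : ℂ) * expFun l (invApply R b.1) := by
  simp [expVector, expFun, real_inner_comm]

theorem norm_inner_expVector_sq (y : (Fin d → ℤ) → ℂ) (l : Fin d → ℤ) :
    ‖inner ℂ (WithLp.toLp 2 fun b : B => y b.1) (expVector R B l)‖ ^ 2
      = (B.card : ℝ)⁻¹ * ‖∑ b ∈ B, star (expFun l (invApply R b)) * y b‖ ^ 2 := by
  have h1 : inner ℂ (WithLp.toLp 2 fun b : B => y b.1) (expVector R B l)
      = ((1 / Real.sqrt (B.card : ℝ) : ℝ) : ℂ) *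
        star (∑ b ∈ B, star (expFun l (invApply R b)) * y b) := by
    rw [PiLp.inner_apply, ← Finset.sum_coe_sort B, star_sum, Finset.mul_sum]
    refine Finset.sum_congr rfl fun b _ => ?_
    rw [expVector_apply]
    simp
    ring
  rw [h1, norm_mul, norm_star, mul_pow, Complex.norm_real, Real.norm_eq_abs, sq_abs, div_pow,
    Real.sq_sqrt (by positivity)]
  simp

theorem norm_toLp_sq (y : (Fin d → ℤ) → ℂ) :
    ‖(WithLp.toLp 2 fun b : B => y b.1 : EuclideanSpace ℂ B)‖ ^ 2 = ∑ b ∈ B, ‖y b‖ ^ 2 := by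
  rw [EuclideanSpace.norm_sq_eq, ← Finset.sum_coe_sort B]

/-- The frame inequality divided by #B, so that both sides refer to the uniform distribution on the
digits. In this form the levels can be iterated along the convolution. -/
theorem IsFrameTriple.analysis_lower (h : IsFrameTriple R B L C D) (y : (Fin d → ℤ) → ℂ) :
    C * ((B.card : ℝ)⁻¹ * ∑ b ∈ B, ‖y b‖ ^ 2)
      ≤ ∑ l ∈ L, ‖(B.card : ℂ)⁻¹ * ∑ b ∈ B, star (expFun l (invApply R b)) * y b‖ ^ 2 := by
  have h1 := h.lower (WithLp.toLp 2 fun b : B => y b.1)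
  simp_rw [norm_inner_expVector_sq, norm_toLp_sq] at h1
  have h2 := mul_le_mul_of_nonneg_left h1 (inv_nonneg.2 h.card_pos.le)
  simp_rw [norm_mul, mul_pow, norm_inv, Complex.norm_natCast]
  rw [← Finset.mul_sum] at h2 ⊢
  calc _ = _ := by ring
    _ ≤ _ := h2
    _ = _ := by ring

theorem IsFrameTriple.analysis_upper (h : IsFrameTriple R B L C D) (y : (Fin d → ℤ) → ℂ) :
    ∑ l ∈ L, ‖(B.card : ℂ)⁻¹ * ∑ b ∈ B, star (expFun l (invApply R b)) * y b‖ ^ 2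
      ≤ D * ((B.card : ℝ)⁻¹ * ∑ b ∈ B, ‖y b‖ ^ 2) := by
  have h1 := h.upper (WithLp.toLp 2 fun b : B => y b.1)
  simp_rw [norm_inner_expVector_sq, norm_toLp_sq] at h1
  have h2 := mul_le_mul_of_nonneg_left h1 (inv_nonneg.2 h.card_pos.le)
  simp_rw [norm_mul, mul_pow, norm_inv, Complex.norm_natCast]
  rw [← Finset.mul_sum] at h2 ⊢
  calc _ = _ := by ring
    _ ≤ _ := h2
    _ = _ := by ring

/-- Synthesis is bounded by the upper frame bound. -/
theorem norm_sum_smul_sq_le_of_bessel {ι H : Type*} [NormedAddCommGroup H] [InnerProductSpace ℂ H]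
    {s : Finset ι} {f : ι → H} {D : ℝ} (hD : 0 ≤ D)
    (hf : ∀ x : H, ∑ k ∈ s, ‖inner ℂ x (f k)‖ ^ 2 ≤ D * ‖x‖ ^ 2)
    (a : ι → ℂ) : ‖∑ k ∈ s, a k • f k‖ ^ 2 ≤ D * ∑ k ∈ s, ‖a k‖ ^ 2 := by
  set y := ∑ k ∈ s, a k • f k with hy
  have h1 : ‖y‖ ^ 2 ≤ ∑ k ∈ s, ‖a k‖ * ‖inner ℂ y (f k)‖ := by
    calc ‖y‖ ^ 2 = ‖inner ℂ y y‖ := by rw [inner_self_eq_norm_sq_to_K]; simp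
      _ = ‖∑ k ∈ s, a k * inner ℂ y (f k)‖ := by
        conv_lhs => rw [hy, inner_sum]
        simp_rw [inner_smul_right]; rw [← hy]
      _ ≤ _ := (norm_sum_le _ _).trans_eq (by simp_rw [norm_mul])
  have h2 := Finset.sum_mul_sq_le_sq_mul_sq s (fun k => ‖a k‖) (fun k => ‖inner ℂ y (f k)‖)
  have h3 : (0 : ℝ) ≤ ∑ k ∈ s, ‖a k‖ ^ 2 := Finset.sum_nonneg fun _ _ => by positivity
  have h4 : (‖y‖ ^ 2) ^ 2 ≤ (D * ∑ k ∈ s, ‖a k‖ ^ 2) * ‖y‖ ^ 2 := by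
    calc (‖y‖ ^ 2) ^ 2 ≤ _ := pow_le_pow_left₀ (by positivity) h1 2
      _ ≤ _ := h2
      _ ≤ (∑ k ∈ s, ‖a k‖ ^ 2) * (D * ‖y‖ ^ 2) := mul_le_mul_of_nonneg_left (hf y) h3
      _ = _ := by ring
  rcases (sq_nonneg ‖y‖).eq_or_lt with h0 | h0
  · rw [← h0]; exact mul_nonneg hD h3
  · rw [sq (‖y‖ ^ 2)] at h4
    exact le_of_mul_le_mul_right h4 h0

/-- A frame with as many elements as the dimension is a Riesz basis with the same lower bound. -/
theorem mul_sum_sq_le_norm_sum_smul_sq {ι H : Type*} [NormedAddCommGroup H]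
    [InnerProductSpace ℂ H] [FiniteDimensional ℂ H] {s : Finset ι} {f : ι → H} {C : ℝ}
    (hC : 0 < C) (hs : s.card = Module.finrank ℂ H)
    (hf : ∀ x : H, C * ‖x‖ ^ 2 ≤ ∑ k ∈ s, ‖inner ℂ x (f k)‖ ^ 2) (a : ι → ℂ) :
    C * ∑ k ∈ s, ‖a k‖ ^ 2 ≤ ‖∑ k ∈ s, a k • f k‖ ^ 2 := by
  let T : H →ₗ[ℂ] (s → ℂ) := LinearMap.pi fun k => (innerSL ℂ (f k.1)).toLinearMap
  have hT : ∀ x k, T x k = inner ℂ (f k.1) x := fun x k => rfl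
  have hinj : Function.Injective T := by
    rw [← LinearMap.ker_eq_bot, LinearMap.ker_eq_bot']
    intro x hx
    have h1 : ∑ k ∈ s, ‖inner ℂ x (f k)‖ ^ 2 = 0 := by
      refine Finset.sum_eq_zero fun k hk => ?_
      have := congrFun hx ⟨k, hk⟩
      rw [hT] at this
      rw [norm_inner_symm, this]; simp
    have h2 := hf x
    rw [h1] at h2
    have h3 : ‖x‖ ^ 2 ≤ 0 := nonpos_of_mul_nonpos_right h2 hC
    exact norm_eq_zero.1 (pow_eq_zero_iff two_ne_zero |>.1 (le_antisymm h3 (by positivity)))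
  have hsurj : Function.Surjective T :=
    (LinearMap.injective_iff_surjective_of_finrank_eq_finrank (by simp [hs])).1 hinj
  -- In equal dimensions the injective analysis map is onto, so some x has exactly the coefficients
  -- a. Pairing the synthesized y with x gives S, and Cauchy–Schwarz with C‖x‖² ≤ S gives the bound.
  obtain ⟨x, hx⟩ := hsurj fun k => a k.1
  have hx' : ∀ k ∈ s, inner ℂ (f k) x = a k := fun k hk => by
    rw [← hT x ⟨k, hk⟩, hx]
  set y := ∑ k ∈ s, a k • f k with hy
  set S := ∑ k ∈ s, ‖a k‖ ^ 2 with hS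
  have h1 : S ≤ ‖y‖ * ‖x‖ := by
    have : inner ℂ y x = (S : ℂ) := by
      rw [hy, sum_inner, hS]
      push_cast
      refine Finset.sum_congr rfl fun k hk => ?_
      rw [inner_smul_left, hx' k hk, Complex.conj_mul']
    calc S = ‖inner ℂ y x‖ := by
          rw [this, Complex.norm_real, Real.norm_of_nonneg]
          exact Finset.sum_nonneg fun _ _ => by positivity
      _ ≤ _ := norm_inner_le_norm y x
  have h2 : C * ‖x‖ ^ 2 ≤ S := by
    refine (hf x).trans_eq (Finset.sum_congr rfl fun k hk => ?_)
    rw [norm_inner_symm, hx' k hk]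
  have hS0 : 0 ≤ S := Finset.sum_nonneg fun _ _ => by positivity
  rcases hS0.eq_or_lt with h0 | h0
  · rw [← h0]; simp
  · have h3 : S ^ 2 ≤ ‖y‖ ^ 2 * ‖x‖ ^ 2 := by
      rw [← mul_pow]; exact pow_le_pow_left₀ hS0 h1 2
    have h4 : (C * S) * S ≤ ‖y‖ ^ 2 * S := by
      calc (C * S) * S = C * S ^ 2 := by ring
        _ ≤ C * (‖y‖ ^ 2 * ‖x‖ ^ 2) := mul_le_mul_of_nonneg_left h3 hC.le
        _ = ‖y‖ ^ 2 * (C * ‖x‖ ^ 2) := by ring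
        _ ≤ _ := mul_le_mul_of_nonneg_left h2 (by positivity)
    exact le_of_mul_le_mul_right h4 h0

theorem norm_sum_smul_expVector_sq (a : (Fin d → ℤ) → ℂ) :
    ‖∑ l ∈ L, a l • expVector R B l‖ ^ 2
      = (B.card : ℝ)⁻¹ * ∑ b ∈ B, ‖∑ l ∈ L, a l * expFun l (invApply R b)‖ ^ 2 := by
  rw [EuclideanSpace.norm_sq_eq, Finset.mul_sum, ← Finset.sum_coe_sort B]
  refine Finset.sum_congr rfl fun b _ => ?_
  have : (∑ l ∈ L, a l • expVector R B l) b = ((1 / Real.sqrt (B.card : ℝ) : ℝ) : ℂ) *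
      ∑ l ∈ L, a l * expFun l (invApply R b.1) := by
    rw [WithLp.ofLp_sum, Finset.sum_apply, Finset.mul_sum]
    refine Finset.sum_congr rfl fun l _ => ?_
    rw [PiLp.smul_apply, expVector_apply, smul_eq_mul]; ring
  rw [this, norm_mul, mul_pow, Complex.norm_real, Real.norm_eq_abs, sq_abs, div_pow,
    Real.sq_sqrt (by positivity)]
  simp

theorem IsFrameTriple.synthesis_upper (h : IsFrameTriple R B L C D) (hD : 0 ≤ D)
    (a : (Fin d → ℤ) → ℂ) :
    (B.card : ℝ)⁻¹ * ∑ b ∈ B, ‖∑ l ∈ L, a l * expFun l (invApply R b)‖ ^ 2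
      ≤ D * ∑ l ∈ L, ‖a l‖ ^ 2 := by
  rw [← norm_sum_smul_expVector_sq]
  exact norm_sum_smul_sq_le_of_bessel hD h.upper a

theorem IsFrameTriple.synthesis_lower (h : IsFrameTriple R B L C D) (hC : 0 < C)
    (hBL : B.card = L.card) (a : (Fin d → ℤ) → ℂ) :
    C * ∑ l ∈ L, ‖a l‖ ^ 2
      ≤ (B.card : ℝ)⁻¹ * ∑ b ∈ B, ‖∑ l ∈ L, a l * expFun l (invApply R b)‖ ^ 2 := by
  rw [← norm_sum_smul_expVector_sq]
  exact mul_sum_sq_le_norm_sum_smul_sq hC (by simp [hBL]) h.lower a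

end Level

/-! ### The finite convolutions -/

section Conv

variable {R : ℕ → Matrix (Fin d) (Fin d) ℤ} {B : ℕ → Finset (Fin d → ℤ)}

theorem isProbabilityMeasure_digitMeasure (hB : ∀ j, (B j).Nonempty) (j : ℕ) :
    IsProbabilityMeasure (digitMeasure R B j) := by
  constructor
  have h : ((B j).card : ℝ≥0) ≠ 0 := by exact_mod_cast (Finset.card_pos.2 (hB j)).ne'
  simp only [digitMeasure, Measure.smul_apply, Measure.finsetSum_apply, measure_univ,
    Finset.sum_const, nsmul_eq_mul, mul_one]
  rw [ENNReal.smul_def, ENNReal.coe_inv h, smul_eq_mul]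
  exact ENNReal.inv_mul_cancel (by simpa using (hB j).ne_empty) (by simp)

theorem isProbabilityMeasure_convMeasure (hB : ∀ j, (B j).Nonempty) (n m : ℕ) :
    IsProbabilityMeasure (convMeasure R B n m) := by
  induction m with
  | zero => unfold convMeasure; infer_instance
  | succ m ih =>
    have := isProbabilityMeasure_digitMeasure (R := R) hB (n + m)
    unfold convMeasure
    infer_instance

theorem conv_digitMeasure (ν : Measure (EuclideanSpace ℝ (Fin d))) [IsFiniteMeasure ν] (j : ℕ) :
    ν.conv (digitMeasure R B j) = ((B j).card : ℝ≥0)⁻¹ •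
      ∑ b ∈ B j, ν.map (· + invApply (prodR R (j + 1)) b) := by
  have h (s : Finset (Fin d → ℤ)) :
      ν.conv (∑ b ∈ s, Measure.dirac (invApply (prodR R (j + 1)) b))
        = ∑ b ∈ s, ν.map (· + invApply (prodR R (j + 1)) b) := by
    classical
    induction s using Finset.induction_on with
    | empty => simp
    | insert b s hb ih =>
      rw [Finset.sum_insert hb, Finset.sum_insert hb, Measure.conv_add, ih, Measure.conv_dirac]
  unfold digitMeasure
  rw [ENNReal.smul_def, Measure.conv_smul_right, h, ENNReal.smul_def]

/-- The measure is finitely supported, so no measurability is required. This allows arbitrary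
functions in the level-by-level induction. -/
theorem integrable_convMeasure {F : Type*} [NormedAddCommGroup F] (n m : ℕ)
    (f : EuclideanSpace ℝ (Fin d) → F) : Integrable f (convMeasure R B n m) := by
  induction m generalizing f with
  | zero => exact integrable_dirac (by simp)
  | succ m ih =>
    rw [convMeasure, conv_digitMeasure]
    refine Integrable.smul_measure_nnreal (integrable_finsetSum_measure.2 fun b _ => ?_)
    exact ((Homeomorph.addRight
      (invApply (prodR R (n + m + 1)) b)).measurableEmbedding.integrable_map_iff).2 (ih _)

theorem integral_convMeasure_succ {F : Type*} [NormedAddCommGroup F] [NormedSpace ℝ F] (n m : ℕ)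
    (f : EuclideanSpace ℝ (Fin d) → F) :
    ∫ x, f x ∂(convMeasure R B n (m + 1)) = ((B (n + m)).card : ℝ)⁻¹ •
      ∑ b ∈ B (n + m), ∫ x, f (x + invApply (prodR R (n + m + 1)) b) ∂(convMeasure R B n m) := by
  have hm (b : Fin d → ℤ) := (Homeomorph.addRight
    (invApply (prodR R (n + m + 1)) b)).measurableEmbedding
  rw [convMeasure, conv_digitMeasure, integral_smul_nnreal_measure, integral_finsetSum_measure]
  · simp only [NNReal.smul_def, NNReal.coe_inv, NNReal.coe_natCast]
    congr 1
    refine Finset.sum_congr rfl fun b _ => ?_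
    exact (hm b).integral_map f
  · intro b _
    exact (hm b).integrable_map_iff.2 (integrable_convMeasure n m _)

theorem ae_convMeasure_succ (n m : ℕ) {p : EuclideanSpace ℝ (Fin d) → Prop}
    (h : ∀ b ∈ B (n + m),
      ∀ᵐ x ∂(convMeasure R B n m), p (x + invApply (prodR R (n + m + 1)) b)) :
    ∀ᵐ x ∂(convMeasure R B n (m + 1)), p x := by
  rw [convMeasure, conv_digitMeasure]
  refine Measure.ae_smul_measure ?_ _
  rw [ae_iff, Measure.finsetSum_apply, Finset.sum_eq_zero_iff]
  intro b hb
  exact ae_iff.1 ((Homeomorph.addRight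
    (invApply (prodR R (n + m + 1)) b)).measurableEmbedding.ae_map_iff.2 (h b hb))

theorem convMeasure_add (k n m : ℕ) :
    convMeasure R B k (n + m) = (convMeasure R B k n).conv (convMeasure R B (k + n) m) := by
  induction m with
  | zero => simp [convMeasure]
  | succ m ih => rw [← add_assoc, convMeasure, ih, convMeasure, Measure.conv_assoc, add_assoc]

theorem det_prodR_ne_zero (hR : ∀ j, (R j).det ≠ 0) (n : ℕ) : (prodR R n).det ≠ 0 := by
  induction n with
  | zero => simp [prodR]
  | succ n ih => rw [prodR, Matrix.det_mul]; exact mul_ne_zero (hR n) ih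

/-- The points of the `n`-th finite convolution are mapped to integer points by `prodR R n`. -/
theorem ae_actReal_prodR (hR : ∀ j, (R j).det ≠ 0) (n : ℕ) :
    ∀ᵐ x ∂(convMeasure R B 0 n), ∃ v : Fin d → ℤ, actReal (prodR R n) x = toReal v := by
  induction n with
  | zero =>
    rw [convMeasure, ae_dirac_eq]
    exact ⟨0, by rw [prodR, actReal_one, toReal_zero]⟩
  | succ n ih =>
    refine ae_convMeasure_succ 0 n fun b _ => ?_
    filter_upwards [ih] with x hx
    obtain ⟨v, hv⟩ := hx
    rw [zero_add]
    refine ⟨(R n).mulVec v + b, ?_⟩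
    rw [actReal_add, actReal_invApply (det_prodR_ne_zero hR _), prodR, actReal_mul, hv,
      actReal_toReal, toReal_add]

end Conv

/-! ### The frequencies with multiplicity -/

/-- The sums in `Λ_n`, counted with multiplicity. -/
def freqMultiset (R : ℕ → Matrix (Fin d) (Fin d) ℤ) (L : ℕ → Finset (Fin d → ℤ)) :
    ℕ → Multiset (Fin d → ℤ)
  | 0 => {0}
  | n + 1 => (freqMultiset R L n).bind fun v =>
      (L n).val.map fun l => v + (prodR R n).transpose.mulVec l

section Freq

variable {R : ℕ → Matrix (Fin d) (Fin d) ℤ} {L : ℕ → Finset (Fin d → ℤ)}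

theorem sum_freqMultiset_succ {M : Type*} [AddCommMonoid M] (n : ℕ) (g : (Fin d → ℤ) → M) :
    ((freqMultiset R L (n + 1)).map g).sum = ((freqMultiset R L n).map fun v =>
      ∑ l ∈ L n, g (v + (prodR R n).transpose.mulVec l)).sum := by
  rw [freqMultiset, Multiset.map_bind, Multiset.sum_bind]
  simp only [Multiset.map_map, Function.comp_def]
  rfl

theorem mem_freqMultiset (hL : ∀ j, (0 : Fin d → ℤ) ∈ L j) {n : ℕ} {v : Fin d → ℤ} :
    v ∈ freqMultiset R L n ↔ v ∈ freqLevel R L n := by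
  induction n generalizing v with
  | zero =>
    simp only [freqMultiset, Multiset.mem_singleton, freqLevel, freqSum, Finset.range_zero,
      Finset.sum_empty, Set.mem_ofPred_eq]
    -- Even the empty sum requires a full admissible sequence; the zero sequence serves.
    exact ⟨fun h => ⟨fun _ => 0, hL, h⟩, fun ⟨_, _, h⟩ => h⟩
  | succ n ih =>
    simp only [freqMultiset, Multiset.mem_bind, Multiset.mem_map]
    constructor
    · rintro ⟨w, hw, l, hl, rfl⟩
      obtain ⟨a, ha, rfl⟩ := ih.1 hw
      refine ⟨Function.update a n l, fun j => ?_, ?_⟩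
      · rcases eq_or_ne j n with rfl | h
        · simpa using hl
        · simpa [h] using ha j
      · rw [freqSum, freqSum, Finset.sum_range_succ, Function.update_self]
        congr 1
        refine Finset.sum_congr rfl fun j hj => ?_
        rw [Function.update_of_ne (Finset.mem_range.1 hj).ne]
    · rintro ⟨a, ha, rfl⟩
      exact ⟨freqSum R a n, ih.2 ⟨a, ha, rfl⟩, a n, ha n, by
        rw [freqSum, freqSum, Finset.sum_range_succ]⟩

end Freq

theorem sum_map_finsetSum_comm {α β M : Type*} [AddCommMonoid M] (s : Multiset α) (t : Finset β)
    (f : α → β → M) :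
    (s.map fun v => ∑ b ∈ t, f v b).sum = ∑ b ∈ t, (s.map fun v => f v b).sum :=
  Multiset.sum_map_sum_map s t.val

/-! ### Frame and Riesz bounds on the finite convolutions. -/

section Tower

variable {R : ℕ → Matrix (Fin d) (Fin d) ℤ} {B L : ℕ → Finset (Fin d → ℤ)} {C D : ℕ → ℝ}

theorem IsFrameTower.det_ne_zero (hT : IsFrameTower R B L C D) (j : ℕ) : (R j).det ≠ 0 :=
  (hT.triple j).expanding.det_ne_zero

theorem IsFrameTower.digits_nonempty (hT : IsFrameTower R B L C D) (j : ℕ) : (B j).Nonempty :=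
  ⟨0, (hT.triple j).zero_mem_digits⟩

theorem IsFrameTower.zero_mem_freqs (hT : IsFrameTower R B L C D) (j : ℕ) :
    (0 : Fin d → ℤ) ∈ L j :=
  (hT.triple j).zero_mem_freqs

theorem IsFrameTower.upper_pos (hT : IsFrameTower R B L C D) (j : ℕ) : 0 < D j :=
  (hT.pos j).trans_le (hT.triple j).le

theorem IsFrameTower.prod_pos (hT : IsFrameTower R B L C D) (n : ℕ) :
    0 < ∏ j ∈ Finset.range n, C j :=
  Finset.prod_pos fun j _ => hT.pos j

theorem IsFrameTower.prod_upper_pos (hT : IsFrameTower R B L C D) (n : ℕ) :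
    0 < ∏ j ∈ Finset.range n, D j :=
  Finset.prod_pos fun j _ => hT.upper_pos j

/-- With P = `prodR R n`, the value of e_{Pᵀl} at y is that of e_l at Py. The point Px is integral
and contributes 1, while P applied to the new digit point is R_n⁻¹b. -/
theorem IsFrameTower.expFun_split (hT : IsFrameTower R B L C D) {n : ℕ}
    {x : EuclideanSpace ℝ (Fin d)} (hx : ∃ z : Fin d → ℤ, actReal (prodR R n) x = toReal z)
    (v l b : Fin d → ℤ) :
    expFun (v + (prodR R n).transpose.mulVec l) (x + invApply (prodR R (n + 1)) b)
      = expFun l (invApply (R n) b) * (expFun v (invApply (prodR R (n + 1)) b) * expFun v x) := by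
  obtain ⟨z, hz⟩ := hx
  rw [expFun_add_left, expFun_add_right, expFun_transpose, actReal_add, hz, expFun_add_right,
    expFun_toReal, prodR, actReal_invApply_mul (hT.det_ne_zero n)
      (det_prodR_ne_zero hT.det_ne_zero n)]
  ring

/-- For fixed v, the coefficients at v + Pᵀl are the one-level analysis of a vector indexed by b,
whose entries are twisted level-n coefficients of translates of w. -/
theorem IsFrameTower.integral_analysis_succ (hT : IsFrameTower R B L C D) (n : ℕ)
    (w : EuclideanSpace ℝ (Fin d) → ℂ) (v l : Fin d → ℤ) :
    ∫ x, star (expFun (v + (prodR R n).transpose.mulVec l) x) * w x ∂(convMeasure R B 0 (n + 1))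
      = ((B n).card : ℂ)⁻¹ * ∑ b ∈ B n, star (expFun l (invApply (R n) b)) *
        (star (expFun v (invApply (prodR R (n + 1)) b)) *
          ∫ x, star (expFun v x) * w (x + invApply (prodR R (n + 1)) b)
            ∂(convMeasure R B 0 n)) := by
  rw [integral_convMeasure_succ, zero_add, Complex.real_smul]
  push_cast
  congr 1
  refine Finset.sum_congr rfl fun b _ => ?_
  rw [← integral_const_mul, ← integral_const_mul]
  refine integral_congr_ae ?_
  filter_upwards [ae_actReal_prodR (B := B) hT.det_ne_zero n] with x hx
  rw [hT.expFun_split hx, star_mul', star_mul']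
  ring

/-- Induction: the one-level inequality is used for each v, then the induction hypothesis for each
translate of w. The twists have modulus 1 and disappear from the norms. -/
theorem IsFrameTower.analysis_lower (hT : IsFrameTower R B L C D) (n : ℕ)
    (w : EuclideanSpace ℝ (Fin d) → ℂ) :
    (∏ j ∈ Finset.range n, C j) * ∫ x, ‖w x‖ ^ 2 ∂(convMeasure R B 0 n)
      ≤ ((freqMultiset R L n).map fun v =>
        ‖∫ x, star (expFun v x) * w x ∂(convMeasure R B 0 n)‖ ^ 2).sum := by
  induction n generalizing w with
  | zero => simp [convMeasure, freqMultiset]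
  | succ n ih =>
    rw [sum_freqMultiset_succ]
    simp_rw [hT.integral_analysis_succ n w]
    refine le_trans ?_ (Multiset.sum_map_le_sum_map _ _ fun v _ =>
      (hT.triple n).analysis_lower _)
    rw [Multiset.sum_map_mul_left, Multiset.sum_map_mul_left, sum_map_finsetSum_comm,
      integral_convMeasure_succ, Finset.prod_range_succ, zero_add, smul_eq_mul]
    simp only [norm_mul, norm_star, norm_expFun, one_mul]
    have hβ := (hT.triple n).card_pos
    have h := Finset.sum_le_sum fun b (_ : b ∈ B n) =>
      ih fun x => w (x + invApply (prodR R (n + 1)) b)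
    rw [← Finset.mul_sum] at h
    calc _ = (C n * ((B n).card : ℝ)⁻¹) * _ := by ring
      _ ≤ (C n * ((B n).card : ℝ)⁻¹) * _ :=
        mul_le_mul_of_nonneg_left h (mul_nonneg (hT.pos n).le (inv_nonneg.2 hβ.le))
      _ = _ := by ring

theorem IsFrameTower.analysis_upper (hT : IsFrameTower R B L C D) (n : ℕ)
    (w : EuclideanSpace ℝ (Fin d) → ℂ) :
    ((freqMultiset R L n).map fun v =>
        ‖∫ x, star (expFun v x) * w x ∂(convMeasure R B 0 n)‖ ^ 2).sum
      ≤ (∏ j ∈ Finset.range n, D j) * ∫ x, ‖w x‖ ^ 2 ∂(convMeasure R B 0 n) := by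
  induction n generalizing w with
  | zero => simp [convMeasure, freqMultiset]
  | succ n ih =>
    rw [sum_freqMultiset_succ]
    simp_rw [hT.integral_analysis_succ n w]
    refine le_trans (Multiset.sum_map_le_sum_map _ _ fun v _ =>
      (hT.triple n).analysis_upper _) ?_
    rw [Multiset.sum_map_mul_left, Multiset.sum_map_mul_left, sum_map_finsetSum_comm,
      integral_convMeasure_succ, Finset.prod_range_succ, zero_add, smul_eq_mul]
    simp only [norm_mul, norm_star, norm_expFun, one_mul]
    have hβ := (hT.triple n).card_pos
    have h := Finset.sum_le_sum fun b (_ : b ∈ B n) =>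
      ih fun x => w (x + invApply (prodR R (n + 1)) b)
    rw [← Finset.mul_sum] at h
    calc _ = (D n * ((B n).card : ℝ)⁻¹) * _ := by ring
      _ ≤ (D n * ((B n).card : ℝ)⁻¹) * _ :=
        mul_le_mul_of_nonneg_left h (mul_nonneg (hT.upper_pos n).le (inv_nonneg.2 hβ.le))
      _ = _ := by ring

/-- On the translate by the b-th digit point, the polynomial is again one over Λ_n, whose
coefficients are twisted one-level syntheses over l. -/
theorem IsFrameTower.integral_synthesis_succ (hT : IsFrameTower R B L C D) (n : ℕ)
    (a : (Fin d → ℤ) → ℂ) :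
    ∫ x, ‖((freqMultiset R L (n + 1)).map fun v => a v * expFun v x).sum‖ ^ 2
        ∂(convMeasure R B 0 (n + 1))
      = ((B n).card : ℝ)⁻¹ * ∑ b ∈ B n, ∫ x, ‖((freqMultiset R L n).map fun v =>
          (expFun v (invApply (prodR R (n + 1)) b) *
            ∑ l ∈ L n, a (v + (prodR R n).transpose.mulVec l) *
              expFun l (invApply (R n) b)) * expFun v x).sum‖ ^ 2 ∂(convMeasure R B 0 n) := by
  rw [integral_convMeasure_succ, zero_add, smul_eq_mul]
  congr 1
  refine Finset.sum_congr rfl fun b _ => integral_congr_ae ?_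
  filter_upwards [ae_actReal_prodR (B := B) hT.det_ne_zero n] with x hx
  rw [sum_freqMultiset_succ]
  simp_rw [hT.expFun_split hx, Finset.mul_sum, Finset.sum_mul]
  refine congrArg (fun z => ‖Multiset.sum z‖ ^ 2) (Multiset.map_congr rfl fun v _ =>
    Finset.sum_congr rfl fun l _ => ?_)
  ring

theorem IsFrameTower.synthesis_upper (hT : IsFrameTower R B L C D) (n : ℕ)
    (a : (Fin d → ℤ) → ℂ) :
    ∫ x, ‖((freqMultiset R L n).map fun v => a v * expFun v x).sum‖ ^ 2 ∂(convMeasure R B 0 n)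
      ≤ (∏ j ∈ Finset.range n, D j) * ((freqMultiset R L n).map fun v => ‖a v‖ ^ 2).sum := by
  induction n generalizing a with
  | zero => simp [convMeasure, freqMultiset]
  | succ n ih =>
    have hβ := inv_nonneg.2 (hT.triple n).card_pos.le
    rw [hT.integral_synthesis_succ]
    refine (mul_le_mul_of_nonneg_left (Finset.sum_le_sum fun b _ => ih _) hβ).trans ?_
    simp only [norm_mul, norm_expFun, one_mul]
    have h := Multiset.sum_map_le_sum_map (s := freqMultiset R L n) _ _ fun v _ =>
      (hT.triple n).synthesis_upper (hT.upper_pos n).le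
        fun l => a (v + (prodR R n).transpose.mulVec l)
    rw [Multiset.sum_map_mul_left, Multiset.sum_map_mul_left, sum_map_finsetSum_comm] at h
    rw [sum_freqMultiset_succ, Finset.prod_range_succ, ← Finset.mul_sum]
    calc _ = (∏ j ∈ Finset.range n, D j) * _ := mul_left_comm _ _ _
      _ ≤ (∏ j ∈ Finset.range n, D j) * _ :=
        mul_le_mul_of_nonneg_left h (hT.prod_upper_pos n).le
      _ = _ := by ring

theorem IsFrameTower.synthesis_lower (hT : IsFrameTower R B L C D)
    (hBL : ∀ j, (B j).card = (L j).card) (n : ℕ) (a : (Fin d → ℤ) → ℂ) :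
    (∏ j ∈ Finset.range n, C j) * ((freqMultiset R L n).map fun v => ‖a v‖ ^ 2).sum
      ≤ ∫ x, ‖((freqMultiset R L n).map fun v => a v * expFun v x).sum‖ ^ 2
        ∂(convMeasure R B 0 n) := by
  induction n generalizing a with
  | zero => simp [convMeasure, freqMultiset]
  | succ n ih =>
    have hβ := inv_nonneg.2 (hT.triple n).card_pos.le
    rw [hT.integral_synthesis_succ]
    refine le_trans ?_ (mul_le_mul_of_nonneg_left (Finset.sum_le_sum fun b _ => ih _) hβ)
    simp only [norm_mul, norm_expFun, one_mul]
    have h := Multiset.sum_map_le_sum_map (s := freqMultiset R L n) _ _ fun v _ =>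
      (hT.triple n).synthesis_lower (hT.pos n) (hBL n)
        fun l => a (v + (prodR R n).transpose.mulVec l)
    rw [Multiset.sum_map_mul_left, Multiset.sum_map_mul_left] at h
    rw [sum_freqMultiset_succ, Finset.prod_range_succ, ← Finset.mul_sum, ← sum_map_finsetSum_comm]
    calc _ = (∏ j ∈ Finset.range n, C j) * _ := by ring
      _ ≤ (∏ j ∈ Finset.range n, C j) * _ :=
        mul_le_mul_of_nonneg_left h (hT.prod_pos n).le
      _ = _ := mul_left_comm _ _ _

/-- The multiplicities of the sums in `Λ_n` are bounded by the upper frame bound. -/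
theorem IsFrameTower.count_le (hT : IsFrameTower R B L C D) (n : ℕ) (v : Fin d → ℤ) :
    ((freqMultiset R L n).count v : ℝ) ≤ ∏ j ∈ Finset.range n, D j := by
  have := isProbabilityMeasure_convMeasure (R := R) hT.digits_nonempty 0 n
  -- The upper bound is tested on e_v: each copy of v contributes 1, and e_v has norm 1.
  have h := hT.analysis_upper n (expFun v)
  simp only [norm_expFun, one_pow, integral_const, probReal_univ, smul_eq_mul, mul_one] at h
  refine le_trans ?_ h
  rw [Finset.sum_multiset_map_count]
  by_cases hv : v ∈ (freqMultiset R L n).toFinset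
  · refine le_trans ?_ (Finset.single_le_sum (fun i _ => by positivity) hv)
    have : ∀ x, star (expFun v x) * expFun v x = 1 := fun x => by
      rw [Complex.star_def, Complex.conj_mul', norm_expFun]; simp
    simp_rw [this]
    simp
  · rw [Multiset.mem_toFinset] at hv
    rw [Multiset.count_eq_zero_of_notMem hv]
    simp only [Nat.cast_zero]
    exact Finset.sum_nonneg fun i _ => by positivity

end Tower

/-! ### The tails of the infinite convolution -/

/-- Restrict the product measure to first coordinate 0. An atom at 0 thus transfers tightness from
the full convolutions to the tails. -/
theorem measure_singleton_zero_mul_le_conv {μ ν : Measure (EuclideanSpace ℝ (Fin d))}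
    [SFinite μ] [SFinite ν] {s : Set (EuclideanSpace ℝ (Fin d))} (hs : MeasurableSet s) :
    μ {0} * ν s ≤ (μ.conv ν) s := by
  rw [Measure.conv, Measure.map_apply (by fun_prop) hs, ← Measure.prod_prod]
  refine measure_mono ?_
  rintro ⟨x, y⟩ ⟨hx, hy⟩
  rw [Set.mem_singleton_iff] at hx
  simp only at hx hy
  simpa [hx] using hy

section Conv

variable {R : ℕ → Matrix (Fin d) (Fin d) ℤ} {B : ℕ → Finset (Fin d → ℤ)}

theorem convMeasure_singleton_zero_ne_zero (hB : ∀ j, (0 : Fin d → ℤ) ∈ B j) (n m : ℕ) :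
    convMeasure R B n m {0} ≠ 0 := by
  induction m with
  | zero => simp [convMeasure]
  | succ m ih =>
    rw [convMeasure]
    have h : digitMeasure R B (n + m) {0} ≠ 0 := by
      have h1 : Measure.dirac (invApply (prodR R (n + m + 1)) 0) {(0 : EuclideanSpace ℝ (Fin d))}
          ≤ ∑ b ∈ B (n + m), Measure.dirac (invApply (prodR R (n + m + 1)) b)
            {(0 : EuclideanSpace ℝ (Fin d))} :=
        Finset.single_le_sum (f := fun b => Measure.dirac (invApply (prodR R (n + m + 1)) b)
          {(0 : EuclideanSpace ℝ (Fin d))}) (fun _ _ => zero_le) (hB (n + m))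
      rw [invApply_zero, Measure.dirac_apply_of_mem (Set.mem_singleton _)] at h1
      rw [digitMeasure, Measure.smul_apply, Measure.finsetSum_apply, ENNReal.smul_def, smul_eq_mul]
      refine mul_ne_zero ?_ (zero_lt_one.trans_le h1).ne'
      simpa using Finset.ne_empty_of_mem (hB (n + m))
    exact ((pos_iff_ne_zero.2 (mul_ne_zero ih h)).trans_le
      (measure_singleton_zero_mul_le_conv (measurableSet_singleton 0))).ne'

theorem charFun_convMeasure_succ (n m : ℕ) (t : EuclideanSpace ℝ (Fin d)) :
    charFun (convMeasure R B n (m + 1)) t = ((B (n + m)).card : ℂ)⁻¹ *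
      ∑ b ∈ B (n + m), charFun (convMeasure R B n m) t *
        Complex.exp (inner ℝ (invApply (prodR R (n + m + 1)) b) t * Complex.I) := by
  rw [charFun_apply, integral_convMeasure_succ, Complex.real_smul]
  push_cast
  congr 1
  refine Finset.sum_congr rfl fun b _ => ?_
  rw [charFun_apply, ← integral_mul_const]
  congr 1; ext x
  rw [← Complex.exp_add, inner_add_left]
  push_cast; ring_nf

/-- On a line through 0 this is a trigonometric polynomial. Analyticity prevents it, being 1 at 0,
from vanishing on an interval. -/
theorem analyticAt_charFun_convMeasure (n m : ℕ) (s : EuclideanSpace ℝ (Fin d)) (r : ℝ) :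
    AnalyticAt ℝ (fun r : ℝ => charFun (convMeasure R B n m) (r • s)) r := by
  induction m with
  | zero => simpa [convMeasure] using analyticAt_const
  | succ m ih =>
    simp_rw [charFun_convMeasure_succ]
    refine analyticAt_const.mul (Finset.analyticAt_fun_sum _ fun b _ => ih.mul ?_)
    simp_rw [inner_smul_right]
    push_cast
    have h : AnalyticAt ℝ (fun r : ℝ => (r : ℂ)) r := Complex.ofRealCLM.analyticAt r
    have h2 : ∀ z : ℂ, AnalyticAt ℝ Complex.exp z := fun z =>
      (analyticAt_cexp (z := z)).restrictScalars
    exact (h2 _).fun_comp ((h.mul analyticAt_const).mul analyticAt_const)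

/-- The characteristic function of a finite convolution can be cancelled in equations between
continuous functions. -/
theorem eq_of_charFun_convMeasure_mul_eq (hB : ∀ j, (B j).Nonempty) (n m : ℕ)
    {g h : EuclideanSpace ℝ (Fin d) → ℂ} (hg : Continuous g) (hh : Continuous h)
    (hgh : ∀ t, charFun (convMeasure R B n m) t * g t = charFun (convMeasure R B n m) t * h t) :
    g = h := by
  have := isProbabilityMeasure_convMeasure (R := R) hB n m
  ext s
  by_contra hne
  -- If g and h differ at s, they differ on the line ℝs near r = 1. There the characteristic
  -- function must vanish, hence on the whole line, against its value 1 at r = 0.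
  have h1 : ∀ᶠ r : ℝ in 𝓝 1, g (r • s) ≠ h (r • s) := by
    have hc1 : Continuous fun r : ℝ => g (r • s) := by fun_prop
    have hc2 : Continuous fun r : ℝ => h (r • s) := by fun_prop
    refine ((hc1.sub hc2).continuousAt.eventually_ne ?_).mono fun r hr => sub_ne_zero.1 hr
    simpa [sub_eq_zero] using hne
  have h2 : (fun r : ℝ => charFun (convMeasure R B n m) (r • s)) =ᶠ[𝓝 1] fun _ => 0 := by
    filter_upwards [h1] with r hr
    by_contra h0
    exact hr (mul_left_cancel₀ h0 (hgh _))
  have h3 := AnalyticOnNhd.eq_of_eventuallyEq (𝕜 := ℝ)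
    (fun r _ => analyticAt_charFun_convMeasure (R := R) (B := B) n m s r)
    (fun r _ => analyticAt_const) h2
  simpa using congrFun h3 0

/-- The finite convolutions as points of the space of probability measures. -/
noncomputable def convProb (R : ℕ → Matrix (Fin d) (Fin d) ℤ) (hB : ∀ j, (B j).Nonempty)
    (n m : ℕ) : ProbabilityMeasure (EuclideanSpace ℝ (Fin d)) :=
  ⟨convMeasure R B n m, isProbabilityMeasure_convMeasure hB n m⟩

variable {μ : ProbabilityMeasure (EuclideanSpace ℝ (Fin d))}

theorem IsInfiniteConvolution.tendsto_convProb (hμ : IsInfiniteConvolution R B μ)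
    (hB : ∀ j, (B j).Nonempty) : Tendsto (convProb R hB 0) atTop (𝓝 μ) :=
  ProbabilityMeasure.tendsto_nhds_iff_toFiniteMeasure_tendsto_nhds _ |>.2 hμ

theorem IsInfiniteConvolution.tendsto_charFun (hμ : IsInfiniteConvolution R B μ)
    (hB : ∀ j, (B j).Nonempty) (t : EuclideanSpace ℝ (Fin d)) :
    Tendsto (fun m => charFun (convMeasure R B 0 m) t) atTop
      (𝓝 (charFun (μ : Measure (EuclideanSpace ℝ (Fin d))) t)) :=
  ProbabilityMeasure.tendsto_iff_tendsto_charFun.1 (hμ.tendsto_convProb hB) t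

theorem IsInfiniteConvolution.isTightMeasureSet (hμ : IsInfiniteConvolution R B μ)
    (hB : ∀ j, (0 : Fin d → ℤ) ∈ B j) (n : ℕ) :
    IsTightMeasureSet (Set.range (convMeasure R B n)) := by
  have hB' : ∀ j, (B j).Nonempty := fun j => ⟨0, hB j⟩
  have := fun m => isProbabilityMeasure_convMeasure (R := R) hB' 0 m
  have h0 : IsTightMeasureSet (Set.range (convMeasure R B 0)) :=
    isTightMeasureSet_of_tendsto_charFun continuous_charFun.continuousAt
      (hμ.tendsto_charFun hB')
  rw [isTightMeasureSet_iff_exists_isCompact_measure_compl_le] at h0 ⊢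
  intro ε hε
  have hc := convMeasure_singleton_zero_ne_zero (R := R) hB 0 n
  have hc' : convMeasure R B 0 n {0} ≠ ⊤ := measure_ne_top _ _
  -- The tolerance is scaled by the atom at 0 of the first n factors, which is then cancelled.
  obtain ⟨K, hK, h⟩ := h0 (convMeasure R B 0 n {0} * ε) (by positivity)
  refine ⟨K, hK, ?_⟩
  rintro _ ⟨m, rfl⟩
  have h1 := h _ ⟨n + m, rfl⟩
  rw [convMeasure_add, zero_add] at h1
  exact (ENNReal.mul_le_mul_iff_right hc hc').1
    ((measure_singleton_zero_mul_le_conv hK.measurableSet.compl).trans h1)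

/-- The tail of a convergent infinite convolution exists. -/
theorem IsInfiniteConvolution.exists_tail (hμ : IsInfiniteConvolution R B μ)
    (hB : ∀ j, (0 : Fin d → ℤ) ∈ B j) (n : ℕ) :
    ∃ ν : ProbabilityMeasure (EuclideanSpace ℝ (Fin d)),
      tailMeasure R B n = ν.toFiniteMeasure ∧
      (μ : Measure (EuclideanSpace ℝ (Fin d)))
        = (convMeasure R B 0 n).conv (ν : Measure (EuclideanSpace ℝ (Fin d))) := by
  have hB' : ∀ j, (B j).Nonempty := fun j => ⟨0, hB j⟩
  have := isProbabilityMeasure_convMeasure (R := R) hB' 0 n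
  have hcomp : IsCompact (closure (Set.range (convProb R hB' n))) := by
    refine isCompact_closure_of_isTightMeasureSet ?_
    refine (hμ.isTightMeasureSet hB n).subset ?_
    rintro _ ⟨_, ⟨m, rfl⟩, rfl⟩
    exact ⟨m, rfl⟩
  -- By compactness each ultrafilter gives a limit ν, and the product of the characteristic
  -- functions of μ_n and ν is that of μ. Cancelling the former shows that all these limits agree,
  -- so the sequence converges.
  have hlim : ∀ U : Ultrafilter ℕ, (U : Filter ℕ) ≤ atTop →
      ∃ ν : ProbabilityMeasure (EuclideanSpace ℝ (Fin d)), Tendsto (convProb R hB' n) U (𝓝 ν) ∧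
        ∀ t, charFun (convMeasure R B 0 n) t * charFun (ν : Measure (EuclideanSpace ℝ (Fin d))) t
          = charFun (μ : Measure (EuclideanSpace ℝ (Fin d))) t := by
    intro U hU
    obtain ⟨ν, -, hν⟩ := hcomp.ultrafilter_le_nhds (U.map (convProb R hB' n))
      (le_principal_iff.2 (mem_map.2 (univ_mem' fun m => subset_closure ⟨m, rfl⟩)))
    have hν' : Tendsto (convProb R hB' n) U (𝓝 ν) := hν
    refine ⟨ν, hν', fun t => ?_⟩
    have h1 := (ProbabilityMeasure.tendsto_iff_forall_integral_rclike_tendsto ℂ).1 hν'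
      (BoundedContinuousFunction.innerProbChar t)
    simp only [← charFun_eq_integral_innerProbChar] at h1
    have h2 := ((hμ.tendsto_charFun hB' t).comp (tendsto_add_atTop_nat n)).mono_left hU
    refine tendsto_nhds_unique (h1.const_mul _) (h2.congr fun m => ?_)
    rw [Function.comp_apply, add_comm, convMeasure_add, charFun_conv, zero_add]
    rfl
  obtain ⟨ν, -, hν⟩ := hlim _ (Ultrafilter.of_le atTop)
  have htend : Tendsto (convProb R hB' n) atTop (𝓝 ν) := by
    rw [tendsto_iff_ultrafilter]
    intro U hU
    obtain ⟨ρ, hρ1, hρ2⟩ := hlim U hU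
    have : ρ = ν := by
      refine Subtype.ext (Measure.ext_of_charFun (μ := (ρ : Measure (EuclideanSpace ℝ (Fin d))))
        (ν := (ν : Measure (EuclideanSpace ℝ (Fin d)))) ?_)
      exact eq_of_charFun_convMeasure_mul_eq (R := R) hB' 0 n continuous_charFun continuous_charFun
        fun t => (hρ2 t).trans (hν t).symm
    rwa [← this]
  refine ⟨ν, ?_, ?_⟩
  · exact Tendsto.limUnder_eq
      (ProbabilityMeasure.tendsto_nhds_iff_toFiniteMeasure_tendsto_nhds _ |>.1 htend)
  · refine Measure.ext_of_charFun (funext fun t => ?_)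
    rw [charFun_conv, hν]

/-- Integrate 1 − cos 2θ = 2(1 − cos θ)(1 + cos θ) ≤ 4(1 − cos θ). Convergence to 1 at t thereby
passes to 2t. -/
theorem one_sub_re_charFun_two_smul_le (ν : Measure (EuclideanSpace ℝ (Fin d)))
    [IsProbabilityMeasure ν] (t : EuclideanSpace ℝ (Fin d)) :
    1 - (charFun ν ((2 : ℝ) • t)).re ≤ 4 * (1 - (charFun ν t).re) := by
  have h (t : EuclideanSpace ℝ (Fin d)) :
      Integrable (fun x => Real.cos (inner ℝ x t)) ν ∧
      (charFun ν t).re = ∫ x, Real.cos (inner ℝ x t) ∂ν := by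
    have hi : Integrable (fun x => Complex.exp (inner ℝ x t * Complex.I)) ν :=
      (integrable_const (1 : ℝ)).mono' (by fun_prop)
        (Eventually.of_forall fun x => by rw [Complex.norm_exp_ofReal_mul_I])
    have hre : ∀ x, Real.cos (inner ℝ x t)
        = RCLike.re (Complex.exp (inner ℝ x t * Complex.I)) := fun x =>
      (Complex.exp_ofReal_mul_I_re _).symm
    simp_rw [hre]
    exact ⟨hi.re, (integral_re hi).symm⟩
  rw [(h _).2, (h _).2]
  have h1 : ∀ t : EuclideanSpace ℝ (Fin d), 1 - ∫ x, Real.cos (inner ℝ x t) ∂ν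
      = ∫ x, (1 - Real.cos (inner ℝ x t)) ∂ν := fun t => by
    rw [integral_sub (integrable_const _) (h t).1]; simp
  rw [h1, h1, ← integral_const_mul]
  refine integral_mono ((integrable_const _).sub (h _).1)
    (((integrable_const _).sub (h _).1).const_mul _) fun x => ?_
  simp only [inner_smul_right, Real.cos_two_mul]
  nlinarith [Real.cos_le_one (inner ℝ x t), Real.neg_one_le_cos (inner ℝ x t)]

/-- If `μ` is the convolution of its `n`-th finite convolution with `ν n`, then `ν n` tends to the
unit mass at `0`. -/
theorem IsInfiniteConvolution.tendsto_dirac (hμ : IsInfiniteConvolution R B μ)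
    (hB : ∀ j, (B j).Nonempty) {ν : ℕ → ProbabilityMeasure (EuclideanSpace ℝ (Fin d))}
    (hν : ∀ n, (μ : Measure (EuclideanSpace ℝ (Fin d)))
      = (convMeasure R B 0 n).conv (ν n : Measure (EuclideanSpace ℝ (Fin d)))) :
    Tendsto ν atTop (𝓝 (diracProba 0)) := by
  -- Where the transform of μ is nonzero, that of ν n is its quotient by the transform of μ_n, which
  -- tends to 1.
  have hpt : ∀ t, charFun (μ : Measure (EuclideanSpace ℝ (Fin d))) t ≠ 0 →
      Tendsto (fun n => (charFun (ν n : Measure (EuclideanSpace ℝ (Fin d))) t).re)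
        atTop (𝓝 1) := by
    intro t ht
    have h1 := hμ.tendsto_charFun hB t
    have h2 := (tendsto_const_nhds (x := charFun (μ : Measure (EuclideanSpace ℝ (Fin d))) t)).div
      h1 ht
    rw [div_self ht] at h2
    have h3 : Tendsto (fun n => charFun (ν n : Measure (EuclideanSpace ℝ (Fin d))) t)
        atTop (𝓝 1) := by
      refine h2.congr' ?_
      filter_upwards [h1.eventually_ne ht] with n hn
      simp only [Pi.div_apply]
      rw [div_eq_iff hn]
      conv_lhs => rw [hν n, charFun_conv]
      ring
    exact (Complex.continuous_re.tendsto 1).comp h3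
  have hdouble : ∀ t, Tendsto (fun n => (charFun (ν n : Measure (EuclideanSpace ℝ (Fin d))) t).re)
        atTop (𝓝 1) →
      Tendsto (fun n => (charFun (ν n : Measure (EuclideanSpace ℝ (Fin d))) ((2 : ℝ) • t)).re)
        atTop (𝓝 1) := by
    intro t ht
    have h1 : Tendsto (fun n => 1 - 4 * (1 -
        (charFun (ν n : Measure (EuclideanSpace ℝ (Fin d))) t).re)) atTop (𝓝 1) := by
      simpa using ((ht.const_sub 1).const_mul 4).const_sub 1
    refine tendsto_of_tendsto_of_tendsto_of_le_of_le h1 tendsto_const_nhds (fun n => ?_) fun n => ?_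
    · have := one_sub_re_charFun_two_smul_le (ν n : Measure (EuclideanSpace ℝ (Fin d))) t
      simp only; linarith
    · exact (Complex.re_le_norm _).trans (norm_charFun_le_one _)
  -- Halve t until the transform of μ is nonzero, which happens by continuity at 0, then double
  -- back.
  have hall : ∀ t, Tendsto (fun n => (charFun (ν n : Measure (EuclideanSpace ℝ (Fin d))) t).re)
        atTop (𝓝 1) := by
    intro t
    have h1 : Tendsto (fun k : ℕ => charFun (μ : Measure (EuclideanSpace ℝ (Fin d)))
        (((1 : ℝ) / 2) ^ k • t)) atTop (𝓝 1) := by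
      have h2 : Tendsto (fun k : ℕ => ((1 : ℝ) / 2) ^ k • t) atTop (𝓝 ((0 : ℝ) • t)) :=
        (tendsto_pow_atTop_nhds_zero_of_lt_one (by norm_num) (by norm_num)).smul_const t
      have h3 := (continuous_charFun (μ := (μ : Measure (EuclideanSpace ℝ (Fin d))))).tendsto
        ((0 : ℝ) • t)
      simpa [Function.comp_def] using h3.comp h2
    obtain ⟨k, hk⟩ := (h1.eventually_ne one_ne_zero).exists
    have h4 : ∀ j : ℕ, Tendsto (fun n => (charFun (ν n : Measure (EuclideanSpace ℝ (Fin d)))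
        ((2 : ℝ) ^ j • ((1 : ℝ) / 2) ^ k • t)).re) atTop (𝓝 1) := by
      intro j
      induction j with
      | zero => simpa using hpt _ hk
      | succ j ih => rw [pow_succ', mul_smul]; exact hdouble _ ih
    have h5 := h4 k
    rwa [smul_smul, ← mul_pow, show (2 : ℝ) * (1 / 2) = 1 by norm_num, one_pow, one_smul] at h5
  rw [ProbabilityMeasure.tendsto_iff_tendsto_charFun]
  intro t
  have h0 : charFun (Measure.dirac (0 : EuclideanSpace ℝ (Fin d))) t = 1 := by simp
  change Tendsto _ _ (𝓝 (charFun (Measure.dirac (0 : EuclideanSpace ℝ (Fin d))) t))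
  rw [h0, tendsto_iff_norm_sub_tendsto_zero]
  -- For |z| ≤ 1 one has |z − 1|² ≤ 2(1 − Re z), so the real parts suffice.
  have h1 : Tendsto (fun n => Real.sqrt (2 * (1 -
      (charFun (ν n : Measure (EuclideanSpace ℝ (Fin d))) t).re))) atTop (𝓝 0) := by
    have := ((hall t).const_sub 1).const_mul 2
    simpa [Function.comp_def] using (Real.continuous_sqrt.tendsto _).comp this
  refine squeeze_zero (fun _ => norm_nonneg _) (fun n => ?_) h1
  refine Real.le_sqrt_of_sq_le ?_
  have h2 := norm_charFun_le_one (μ := (ν n : Measure (EuclideanSpace ℝ (Fin d)))) t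
  have h3 := Complex.sq_norm (charFun (ν n : Measure (EuclideanSpace ℝ (Fin d))) t)
  rw [Complex.normSq_apply] at h3
  rw [Complex.sq_norm, Complex.normSq_apply]
  simp only [Complex.sub_re, Complex.one_re, Complex.sub_im, Complex.one_im, sub_zero]
  nlinarith [norm_nonneg (charFun (ν n : Measure (EuclideanSpace ℝ (Fin d))) t)]

end Conv

/-! ### Hilbert space lemmas -/

section Hilbert

variable {ι H : Type*} [NormedAddCommGroup H] [InnerProductSpace ℂ H]

/-- An upper bound for the synthesis operator is an upper bound for the analysis operator. -/
theorem sum_norm_inner_sq_le_of_synthesis {s : Finset ι} {f : ι → H} {D : ℝ} (hD : 0 ≤ D)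
    (hf : ∀ a : ι → ℂ, ‖∑ k ∈ s, a k • f k‖ ^ 2 ≤ D * ∑ k ∈ s, ‖a k‖ ^ 2) (x : H) :
    ∑ k ∈ s, ‖inner ℂ x (f k)‖ ^ 2 ≤ D * ‖x‖ ^ 2 := by
  set a : ι → ℂ := fun k => inner ℂ (f k) x with ha
  have hS : ∑ k ∈ s, ‖inner ℂ x (f k)‖ ^ 2 = ∑ k ∈ s, ‖a k‖ ^ 2 := by
    refine Finset.sum_congr rfl fun k _ => ?_
    rw [ha, norm_inner_symm]
  rw [hS]
  set S := ∑ k ∈ s, ‖a k‖ ^ 2 with hSdef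
  have hS0 : 0 ≤ S := Finset.sum_nonneg fun _ _ => by positivity
  set y := ∑ k ∈ s, a k • f k with hy
  have h1 : S ≤ ‖y‖ * ‖x‖ := by
    have : inner ℂ y x = (S : ℂ) := by
      rw [hy, sum_inner, hSdef]
      push_cast
      refine Finset.sum_congr rfl fun k _ => ?_
      rw [inner_smul_left, ← Complex.conj_mul']
    calc S = ‖inner ℂ y x‖ := by rw [this, Complex.norm_real, Real.norm_of_nonneg hS0]
      _ ≤ _ := norm_inner_le_norm y x
  rcases hS0.eq_or_lt with h0 | h0
  · rw [← h0]; positivity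
  · have h3 : S * S ≤ (D * ‖x‖ ^ 2) * S := by
      calc S * S = S ^ 2 := by ring
        _ ≤ (‖y‖ * ‖x‖) ^ 2 := pow_le_pow_left₀ hS0 h1 2
        _ = ‖y‖ ^ 2 * ‖x‖ ^ 2 := by ring
        _ ≤ (D * S) * ‖x‖ ^ 2 := mul_le_mul_of_nonneg_right (hf a) (by positivity)
        _ = _ := by ring
    exact le_of_mul_le_mul_right h3 h0

end Hilbert

section L2

variable {α : Type*} [MeasurableSpace α] {ρ : Measure α}

theorem inner_toLp_toLp {f g : α → ℂ} (hf : MemLp f 2 ρ) (hg : MemLp g 2 ρ) :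
    inner ℂ (hf.toLp f) (hg.toLp g) = ∫ x, star (f x) * g x ∂ρ := by
  rw [L2.inner_def]
  refine integral_congr_ae ?_
  filter_upwards [hf.coeFn_toLp, hg.coeFn_toLp] with x hx hy
  rw [hx, hy, RCLike.inner_apply, mul_comm]
  rfl

theorem norm_toLp_two_sq {f : α → ℂ} (hf : MemLp f 2 ρ) :
    ‖hf.toLp f‖ ^ 2 = ∫ x, ‖f x‖ ^ 2 ∂ρ := by
  have h := inner_toLp_toLp hf hf
  rw [inner_self_eq_norm_sq_to_K] at h
  have h2 : ∀ x, star (f x) * f x = ((‖f x‖ ^ 2 : ℝ) : ℂ) := fun x => by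
    rw [Complex.star_def, Complex.conj_mul']; push_cast; rfl
  simp_rw [h2] at h
  rw [integral_complex_ofReal] at h
  exact Complex.ofReal_injective (by push_cast at h ⊢; exact h)

theorem sq_integral_le_integral_sq [IsProbabilityMeasure ρ] {f : α → ℝ} (hf : MemLp f 2 ρ) :
    (∫ x, f x ∂ρ) ^ 2 ≤ ∫ x, f x ^ 2 ∂ρ := by
  have h := ProbabilityTheory.variance_nonneg f ρ
  rw [ProbabilityTheory.variance_eq_sub hf] at h
  simpa using h

end L2

/-! ### Uniform product bounds and the passage to the limit measure. -/

section Tower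

variable {R : ℕ → Matrix (Fin d) (Fin d) ℤ} {B L : ℕ → Finset (Fin d → ℤ)} {C D : ℕ → ℝ}
  {μ : ProbabilityMeasure (EuclideanSpace ℝ (Fin d))}

theorem IsFrameTower.exists_lower (hT : IsFrameTower R B L C D) :
    ∃ c : ℝ, 0 < c ∧ ∀ n, c ≤ ∏ j ∈ Finset.range n, C j := by
  obtain ⟨c, hc, h⟩ := hT.prod_lower
  -- The reciprocals converge, hence are bounded; this bounds every partial product from below, not
  -- only late ones.
  obtain ⟨M, hM⟩ := (h.inv₀ hc.ne').bddAbove_range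
  have hM' : ∀ n, (∏ j ∈ Finset.range n, C j)⁻¹ ≤ M := fun n => hM ⟨n, rfl⟩
  have hM0 : 0 < M := (inv_pos.2 (hT.prod_pos 0)).trans_le (hM' 0)
  exact ⟨M⁻¹, inv_pos.2 hM0, fun n => inv_le_of_inv_le₀ (hT.prod_pos n) (hM' n)⟩

theorem IsFrameTower.exists_upper (hT : IsFrameTower R B L C D) :
    ∃ c : ℝ, 0 < c ∧ ∀ n, ∏ j ∈ Finset.range n, D j ≤ c := by
  obtain ⟨c, h⟩ := hT.prod_upper
  obtain ⟨M, hM⟩ := h.bddAbove_range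
  exact ⟨M, (hT.prod_upper_pos 0).trans_le (hM ⟨0, rfl⟩), fun n => hM ⟨n, rfl⟩⟩

/-! ### Frequency levels -/

theorem freqLevel_mono (hL : ∀ j, (0 : Fin d → ℤ) ∈ L j) : Monotone (freqLevel R L) := by
  refine monotone_nat_of_le_succ fun n v hv => ?_
  obtain ⟨l, hl, rfl⟩ := hv
  refine ⟨Function.update l n 0, fun j => ?_, ?_⟩
  · rcases eq_or_ne j n with rfl | h
    · simpa using hL j
    · simpa [h] using hl j
  · rw [freqSum, freqSum, Finset.sum_range_succ, Function.update_self, Matrix.mulVec_zero,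
      add_zero]
    refine Finset.sum_congr rfl fun j hj => ?_
    rw [Function.update_of_ne (Finset.mem_range.1 hj).ne]

theorem freqLevel_subset_freqSet {n : ℕ} (hn : 1 ≤ n) : freqLevel R L n ⊆ freqSet R L :=
  Set.subset_biUnion_of_mem (u := fun n => freqLevel R L n) hn

theorem eventually_subset_freqMultiset (hL : ∀ j, (0 : Fin d → ℤ) ∈ L j)
    {s : Finset (Fin d → ℤ)} (hs : ∀ v ∈ s, v ∈ freqSet R L) :
    ∀ᶠ n in atTop, ∀ v ∈ s, v ∈ freqMultiset R L n := by
  rw [Filter.eventually_all_finset]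
  intro v hv
  obtain ⟨n, -, hn⟩ := Set.mem_iUnion₂.1 (hs v hv)
  filter_upwards [eventually_ge_atTop n] with m hm
  exact (mem_freqMultiset hL).2 (freqLevel_mono hL hm hn)

/-! ### Riesz bounds -/

/-- Dividing each coefficient by its multiplicity turns the sum over representations into a sum over
distinct frequencies. The cost in ℓ² is a weight between 1/K and 1 when multiplicities are at most
K, hence the constant c/K in the Riesz bound. -/
theorem sum_ite_div_count (m : Multiset (Fin d → ℤ)) {s : Finset (Fin d → ℤ)}
    (hs : ∀ v ∈ s, v ∈ m) (a g : (Fin d → ℤ) → ℂ) :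
    (m.map fun v => (if v ∈ s then a v / (m.count v : ℂ) else 0) * g v).sum
      = ∑ v ∈ s, a v * g v := by
  rw [Finset.sum_multiset_map_count]
  have hsub : s ⊆ m.toFinset := fun v hv => Multiset.mem_toFinset.2 (hs v hv)
  rw [← Finset.sum_subset hsub]
  · refine Finset.sum_congr rfl fun v hv => ?_
    have : (m.count v : ℂ) ≠ 0 := by
      exact_mod_cast (Multiset.count_pos.2 (hs v hv)).ne'
    rw [if_pos hv, nsmul_eq_mul]
    field_simp
  · intro v _ hv
    simp [hv]

theorem sum_norm_ite_div_count_sq (m : Multiset (Fin d → ℤ)) {s : Finset (Fin d → ℤ)}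
    (hs : ∀ v ∈ s, v ∈ m) (a : (Fin d → ℤ) → ℂ) :
    (m.map fun v => ‖if v ∈ s then a v / (m.count v : ℂ) else 0‖ ^ 2).sum
      = ∑ v ∈ s, (m.count v : ℝ)⁻¹ * ‖a v‖ ^ 2 := by
  rw [Finset.sum_multiset_map_count]
  have hsub : s ⊆ m.toFinset := fun v hv => Multiset.mem_toFinset.2 (hs v hv)
  rw [← Finset.sum_subset hsub]
  · refine Finset.sum_congr rfl fun v hv => ?_
    have : (m.count v : ℝ) ≠ 0 := by
      exact_mod_cast (Multiset.count_pos.2 (hs v hv)).ne'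
    rw [if_pos hv, nsmul_eq_mul, norm_div, Complex.norm_natCast]
    field_simp
  · intro v _ hv
    simp [hv]

theorem IsFrameTower.integral_sum_upper (hT : IsFrameTower R B L C D) {K : ℝ}
    (hK : ∀ n, ∏ j ∈ Finset.range n, D j ≤ K) (n : ℕ) {s : Finset (Fin d → ℤ)}
    (hs : ∀ v ∈ s, v ∈ freqMultiset R L n) (a : (Fin d → ℤ) → ℂ) :
    ∫ x, ‖∑ v ∈ s, a v * expFun v x‖ ^ 2 ∂(convMeasure R B 0 n) ≤ K * ∑ v ∈ s, ‖a v‖ ^ 2 := by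
  have h := hT.synthesis_upper n
    fun v => if v ∈ s then a v / ((freqMultiset R L n).count v : ℂ) else 0
  simp_rw [sum_ite_div_count _ hs, sum_norm_ite_div_count_sq _ hs] at h
  refine h.trans (mul_le_mul (hK n) (Finset.sum_le_sum fun v hv => ?_)
    (Finset.sum_nonneg fun _ _ => by positivity) ((hT.prod_upper_pos n).le.trans (hK n)))
  have : (1 : ℝ) ≤ (freqMultiset R L n).count v := by
    exact_mod_cast Multiset.count_pos.2 (hs v hv)
  exact mul_le_of_le_one_left (by positivity) (inv_le_one_of_one_le₀ this)

theorem IsFrameTower.integral_sum_lower (hT : IsFrameTower R B L C D) {c K : ℝ}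
    (hcC : ∀ n, c ≤ ∏ j ∈ Finset.range n, C j) (hK : ∀ n, ∏ j ∈ Finset.range n, D j ≤ K)
    (hBL : ∀ j, (B j).card = (L j).card) (n : ℕ) {s : Finset (Fin d → ℤ)}
    (hs : ∀ v ∈ s, v ∈ freqMultiset R L n) (a : (Fin d → ℤ) → ℂ) :
    c / K * ∑ v ∈ s, ‖a v‖ ^ 2
      ≤ ∫ x, ‖∑ v ∈ s, a v * expFun v x‖ ^ 2 ∂(convMeasure R B 0 n) := by
  have h := hT.synthesis_lower hBL n
    fun v => if v ∈ s then a v / ((freqMultiset R L n).count v : ℂ) else 0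
  simp_rw [sum_ite_div_count _ hs, sum_norm_ite_div_count_sq _ hs] at h
  refine le_trans ?_ h
  rw [div_mul_eq_mul_div, mul_div_assoc, Finset.sum_div]
  refine mul_le_mul (hcC n) (Finset.sum_le_sum fun v hv => ?_)
    (Finset.sum_nonneg fun v _ => div_nonneg (by positivity)
      ((hT.prod_upper_pos n).le.trans (hK n))) (hT.prod_pos n).le
  have h1 : (0 : ℝ) < (freqMultiset R L n).count v := by
    exact_mod_cast Multiset.count_pos.2 (hs v hv)
  rw [div_eq_inv_mul]
  exact mul_le_mul_of_nonneg_right (inv_anti₀ h1 ((hT.count_le n v).trans (hK n)))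
    (by positivity)

theorem IsInfiniteConvolution.tendsto_integral (hμ : IsInfiniteConvolution R B μ)
    (hB : ∀ j, (B j).Nonempty) {f : EuclideanSpace ℝ (Fin d) → ℝ} (hf : Continuous f) {K : ℝ}
    (hK : ∀ x, ‖f x‖ ≤ K) :
    Tendsto (fun n => ∫ x, f x ∂(convMeasure R B 0 n)) atTop (𝓝 (∫ x, f x ∂(μ : Measure _))) :=
  ProbabilityMeasure.tendsto_iff_forall_integral_tendsto.1 (hμ.tendsto_convProb hB)
    (BoundedContinuousFunction.ofNormedAddCommGroup f hf K hK)

theorem IsFrameTower.tendsto_integral_sum (hT : IsFrameTower R B L C D)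
    (hμ : IsInfiniteConvolution R B μ) (s : Finset (Fin d → ℤ)) (a : (Fin d → ℤ) → ℂ) :
    Tendsto (fun n => ∫ x, ‖∑ v ∈ s, a v * expFun v x‖ ^ 2 ∂(convMeasure R B 0 n)) atTop
      (𝓝 (∫ x, ‖∑ v ∈ s, a v * expFun v x‖ ^ 2 ∂(μ : Measure (EuclideanSpace ℝ (Fin d))))) := by
  refine hμ.tendsto_integral hT.digits_nonempty ?_ (K := (∑ v ∈ s, ‖a v‖) ^ 2) fun x => ?_
  · exact (continuous_finsetSum _ fun v _ =>
      continuous_const.mul (continuous_expFun v)).norm.pow 2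
  · rw [norm_pow, norm_norm]
    refine pow_le_pow_left₀ (norm_nonneg _) ((norm_sum_le _ _).trans_eq ?_) 2
    simp

/-- The exponential as an element of `L²`. -/
noncomputable def expLp (μ : ProbabilityMeasure (EuclideanSpace ℝ (Fin d))) (v : Fin d → ℤ) :
    Lp ℂ 2 (μ : Measure (EuclideanSpace ℝ (Fin d))) :=
  (memLp_expFun (μ : Measure (EuclideanSpace ℝ (Fin d))) v).toLp (expFun v)

theorem norm_sum_smul_expLp_sq (s : Finset (Fin d → ℤ)) (a : (Fin d → ℤ) → ℂ) :
    ‖∑ v ∈ s, a v • expLp μ v‖ ^ 2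
      = ∫ x, ‖∑ v ∈ s, a v * expFun v x‖ ^ 2 ∂(μ : Measure (EuclideanSpace ℝ (Fin d))) := by
  have hm : MemLp (fun x => ∑ v ∈ s, a v * expFun v x) 2
      (μ : Measure (EuclideanSpace ℝ (Fin d))) :=
    memLp_finsetSum _ fun v _ => (memLp_expFun _ v).const_mul (a v)
  rw [← norm_toLp_two_sq hm]
  congr 2
  have h : ∀ t : Finset (Fin d → ℤ), ∀ hm : MemLp (fun x => ∑ v ∈ t, a v * expFun v x) 2
      (μ : Measure (EuclideanSpace ℝ (Fin d))), ∑ v ∈ t, a v • expLp μ v = hm.toLp _ := by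
    classical
    intro t
    induction t using Finset.induction_on with
    | empty => intro hm; simp
    | insert v t hv ih =>
      intro hm
      rw [Finset.sum_insert hv,
        ih (memLp_finsetSum _ fun v _ => (memLp_expFun _ v).const_mul (a v)), expLp,
        ← MemLp.toLp_const_smul, ← MemLp.toLp_add]
      congr 1
      ext x
      simp [Finset.sum_insert hv]
  exact h s hm

/-- A finite set of frequencies lies in Λ_n for all large n, where the bound is uniform; weak
convergence carries it to μ. -/
theorem IsFrameTower.norm_sum_smul_upper (hT : IsFrameTower R B L C D)
    (hμ : IsInfiniteConvolution R B μ) {K : ℝ} (hK : ∀ n, ∏ j ∈ Finset.range n, D j ≤ K)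
    {s : Finset (Fin d → ℤ)} (hs : ∀ v ∈ s, v ∈ freqSet R L) (a : (Fin d → ℤ) → ℂ) :
    ‖∑ v ∈ s, a v • expLp μ v‖ ^ 2 ≤ K * ∑ v ∈ s, ‖a v‖ ^ 2 := by
  rw [norm_sum_smul_expLp_sq]
  refine le_of_tendsto (hT.tendsto_integral_sum hμ s a) ?_
  filter_upwards [eventually_subset_freqMultiset hT.zero_mem_freqs hs] with n hn
  exact hT.integral_sum_upper hK n hn a

theorem IsFrameTower.norm_sum_smul_lower (hT : IsFrameTower R B L C D)
    (hμ : IsInfiniteConvolution R B μ) {c K : ℝ}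
    (hcC : ∀ n, c ≤ ∏ j ∈ Finset.range n, C j) (hK : ∀ n, ∏ j ∈ Finset.range n, D j ≤ K)
    (hBL : ∀ j, (B j).card = (L j).card)
    {s : Finset (Fin d → ℤ)} (hs : ∀ v ∈ s, v ∈ freqSet R L) (a : (Fin d → ℤ) → ℂ) :
    c / K * ∑ v ∈ s, ‖a v‖ ^ 2 ≤ ‖∑ v ∈ s, a v • expLp μ v‖ ^ 2 := by
  rw [norm_sum_smul_expLp_sq]
  refine ge_of_tendsto (hT.tendsto_integral_sum hμ s a) ?_
  filter_upwards [eventually_subset_freqMultiset hT.zero_mem_freqs hs] with n hn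
  exact hT.integral_sum_lower hcC hK hBL n hn a

theorem IsFrameTower.sum_inner_expLp_le (hT : IsFrameTower R B L C D)
    (hμ : IsInfiniteConvolution R B μ) {K : ℝ} (hK0 : 0 ≤ K)
    (hK : ∀ n, ∏ j ∈ Finset.range n, D j ≤ K)
    (x : Lp ℂ 2 (μ : Measure (EuclideanSpace ℝ (Fin d)))) (s : Finset (freqSet R L)) :
    ∑ v ∈ s, ‖inner ℂ x (expFamily μ (freqSet R L) v)‖ ^ 2 ≤ K * ‖x‖ ^ 2 := by
  have h := sum_norm_inner_sq_le_of_synthesis hK0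
    (s := s.map (Function.Embedding.subtype _)) (f := expLp μ)
    (fun a => hT.norm_sum_smul_upper hμ hK (by simp +contextual) a) x
  rwa [Finset.sum_map] at h

theorem IsFrameTower.isRieszSequence (hT : IsFrameTower R B L C D)
    (hμ : IsInfiniteConvolution R B μ) (hBL : ∀ j, (B j).card = (L j).card) :
    IsRieszSequence (expFamily μ (freqSet R L)) := by
  obtain ⟨c, hc, hcC⟩ := hT.exists_lower
  obtain ⟨K, hK0, hK⟩ := hT.exists_upper
  refine ⟨c / K, K, div_pos hc hK0, hK0, fun a => ?_⟩
  have hs : ∀ v ∈ a.support.map (Function.Embedding.subtype _), v ∈ freqSet R L := by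
    simp +contextual
  -- Coefficients indexed by Λ are extended by 0 to all integer vectors.
  have h1 := hT.norm_sum_smul_upper hμ hK hs (Function.extend Subtype.val a 0)
  have h2 := hT.norm_sum_smul_lower hμ hcC hK hBL hs (Function.extend Subtype.val a 0)
  simp only [Finset.sum_map, Function.Embedding.subtype_apply,
    Subtype.val_injective.extend_apply] at h1 h2
  exact ⟨h2, h1⟩

end Tower

/-! ### The lower frame bound -/

section Tower

variable {R : ℕ → Matrix (Fin d) (Fin d) ℤ} {B L : ℕ → Finset (Fin d → ℤ)} {C D : ℕ → ℝ}
  {μ : ProbabilityMeasure (EuclideanSpace ℝ (Fin d))}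

theorem tailBound_le {n : ℕ} (hn : 1 ≤ n) {v : Fin d → ℤ} (hv : v ∈ freqLevel R L n) :
    tailBound R B L
      ≤ ‖fourier (tailMeasure R B n : Measure (EuclideanSpace ℝ (Fin d))) (toReal v)‖ ^ 2 := by
  refine csInf_le ⟨0, ?_⟩ ⟨n, hn, v, hv, rfl⟩
  rintro _ ⟨_, _, _, _, rfl⟩
  positivity

/-- Translations of a uniformly continuous bounded function, with a continuous modulus. -/
theorem norm_sub_sq_le_of_uniformContinuous {E : Type*} [NormedAddCommGroup E] {f : E → ℂ}
    {K : ℝ} (hK : ∀ x, ‖f x‖ ≤ K) (hf : UniformContinuous f) {ε : ℝ} (hε : 0 < ε) :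
    ∃ η > 0, ∀ x y, ‖f (y + x) - f x‖ ^ 2 ≤ ε + (2 * K) ^ 2 * min 1 (‖y‖ / η) := by
  obtain ⟨η, hη, h⟩ := Metric.uniformContinuous_iff.1 hf (Real.sqrt ε) (Real.sqrt_pos.2 hε)
  refine ⟨η, hη, fun x y => ?_⟩
  rcases lt_or_ge ‖y‖ η with hy | hy
  · have h1 : dist (y + x) x < η := by simpa [dist_eq_norm] using hy
    have h2 := h h1
    rw [dist_eq_norm] at h2
    have h3 : ‖f (y + x) - f x‖ ^ 2 ≤ ε := by
      rw [← Real.sq_sqrt hε.le]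
      exact pow_le_pow_left₀ (norm_nonneg _) h2.le 2
    have h4 : 0 ≤ (2 * K) ^ 2 * min 1 (‖y‖ / η) := by positivity
    linarith
  · rw [min_eq_left ((one_le_div hη).2 hy)]
    have h2 : ‖f (y + x) - f x‖ ≤ 2 * K := by
      refine (norm_sub_le _ _).trans ?_
      linarith [hK (y + x), hK x]
    have h3 := pow_le_pow_left₀ (norm_nonneg _) h2 2
    linarith

/-- Sampling `f` at the points of the `n`-th finite convolution changes its coefficients by
little. -/
theorem IsFrameTower.sum_sub_le (hT : IsFrameTower R B L C D) {n : ℕ}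
    {ν : Measure (EuclideanSpace ℝ (Fin d))} [IsProbabilityMeasure ν]
    (hν : (μ : Measure (EuclideanSpace ℝ (Fin d))) = (convMeasure R B 0 n).conv ν)
    {f : EuclideanSpace ℝ (Fin d) → ℂ} (hf : Continuous f) {K : ℝ} (hK : ∀ x, ‖f x‖ ≤ K)
    {g : EuclideanSpace ℝ (Fin d) → ℝ} (hg : Integrable g ν)
    (hfg : ∀ x y, ‖f (y + x) - f x‖ ^ 2 ≤ g y) :
    ∑ v ∈ (freqMultiset R L n).toFinset,
      ‖(∫ x, star (expFun v x) * f x ∂(convMeasure R B 0 n)) * fourier ν (toReal v) -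
        ∫ x, star (expFun v x) * f x ∂(μ : Measure (EuclideanSpace ℝ (Fin d)))‖ ^ 2
      ≤ (∏ j ∈ Finset.range n, D j) * ∫ y, g y ∂ν := by
  have := isProbabilityMeasure_convMeasure (R := R) hT.digits_nonempty 0 n
  have hcont : ∀ v : Fin d → ℤ, Continuous fun x => star (expFun v x) := fun v => (continuous_expFun v).star
  -- G v y is the v-th coefficient over μ_n of f minus its translate by y.
  let G : (Fin d → ℤ) → EuclideanSpace ℝ (Fin d) → ℂ := fun v y =>
    ∫ x, star (expFun v x) * (f x - f (y + x)) ∂(convMeasure R B 0 n)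
  have hpt : ∀ v x y, ‖star (expFun v x) * (f x - f (y + x))‖ ≤ 2 * K := fun v x y => by
    rw [norm_mul, norm_star, norm_expFun, one_mul]
    exact (norm_sub_le _ _).trans (by linarith [hK x, hK (y + x)])
  have hGc : ∀ v, Continuous (G v) := fun v => by
    refine continuous_of_dominated (bound := fun _ => 2 * K) (fun y => ?_)
      (fun y => Eventually.of_forall fun x => hpt v x y) (integrable_const _)
      (Eventually.of_forall fun x => ?_)
    · exact ((hcont v).mul (hf.sub (hf.comp (continuous_const.add continuous_id)))
        ).aestronglyMeasurable
    · exact continuous_const.mul (continuous_const.sub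
        (hf.comp (continuous_id.add continuous_const)))
  have hGb : ∀ v y, ‖G v y‖ ≤ 2 * K := fun v y => by
    refine (norm_integral_le_of_norm_le_const (Eventually.of_forall fun x => hpt v x y)).trans ?_
    simp
  have hGm : ∀ v, MemLp (fun y => ‖G v y‖) 2 ν := fun v =>
    MemLp.of_bound (hGc v).norm.aestronglyMeasurable (2 * K)
      (Eventually.of_forall fun y => by rw [norm_norm]; exact hGb v y)
  -- Fubini for μ = ν * μ_n, with e_v(y + x) = e_v(y) e_v(x), writes the error as an average of G
  -- over ν.
  have heq : ∀ v, (∫ x, star (expFun v x) * f x ∂(convMeasure R B 0 n)) * fourier ν (toReal v) -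
      ∫ x, star (expFun v x) * f x ∂(μ : Measure (EuclideanSpace ℝ (Fin d)))
      = ∫ y, star (expFun v y) * G v y ∂ν := fun v => by
    have hint : Integrable (fun x => star (expFun v x) * f x) (ν.conv (convMeasure R B 0 n)) :=
      (integrable_const K).mono' ((hcont v).mul hf).aestronglyMeasurable
        (Eventually.of_forall fun x => by
          rw [norm_mul, norm_star, norm_expFun, one_mul]; exact hK x)
    rw [hν, Measure.conv_comm, integral_conv hint, fourier_eq_integral_expFun, mul_comm,
      ← integral_mul_const]
    have h1 : ∀ y, ∫ x, star (expFun v (y + x)) * f (y + x) ∂(convMeasure R B 0 n)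
        = star (expFun v y) * ∫ x, star (expFun v x) * f (y + x) ∂(convMeasure R B 0 n) :=
      fun y => by
        rw [← integral_const_mul]
        congr 1; ext x
        rw [expFun_add_right, star_mul']; ring
    have h2 : ∀ y, G v y = (∫ x, star (expFun v x) * f x ∂(convMeasure R B 0 n)) -
        ∫ x, star (expFun v x) * f (y + x) ∂(convMeasure R B 0 n) := fun y => by
      rw [← integral_sub (integrable_convMeasure 0 n _) (integrable_convMeasure 0 n _)]
      exact integral_congr_ae (Eventually.of_forall fun x => mul_sub _ _ _)
    have h3 : ∀ y, ∫ x, star (expFun v (y + x)) * f (y + x) ∂(convMeasure R B 0 n)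
        = star (expFun v y) * (∫ x, star (expFun v x) * f x ∂(convMeasure R B 0 n))
          - star (expFun v y) * G v y := fun y => by
      rw [h1, h2]; ring
    simp_rw [h3]
    rw [integral_sub, sub_sub_cancel]
    · exact ((integrable_const (1 : ℝ)).mono' (hcont v).aestronglyMeasurable
        (Eventually.of_forall fun x => by rw [norm_star, norm_expFun])).mul_const _
    · refine (integrable_const (2 * K)).mono' ((hcont v).mul (hGc v)).aestronglyMeasurable
        (Eventually.of_forall fun x => ?_)
      rw [norm_mul, norm_star, norm_expFun, one_mul]
      exact hGb v x
  -- For each fixed y, the upper bound on μ_n applied to f minus its translate; distinct frequencies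
  -- number no more than their copies.
  have hbd : ∀ y, ∑ v ∈ (freqMultiset R L n).toFinset, ‖G v y‖ ^ 2
      ≤ (∏ j ∈ Finset.range n, D j) * g y := fun y => by
    have h1 : ∑ v ∈ (freqMultiset R L n).toFinset, ‖G v y‖ ^ 2
        ≤ ((freqMultiset R L n).map fun v => ‖G v y‖ ^ 2).sum := by
      rw [Finset.sum_multiset_map_count]
      refine Finset.sum_le_sum fun v hv => ?_
      rw [nsmul_eq_mul]
      refine le_mul_of_one_le_left (by positivity) ?_
      exact_mod_cast Multiset.count_pos.2 (Multiset.mem_toFinset.1 hv)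
    refine (h1.trans (hT.analysis_upper n fun x => f x - f (y + x))).trans
      (mul_le_mul_of_nonneg_left ?_ (hT.prod_upper_pos n).le)
    calc _ ≤ ∫ _, g y ∂(convMeasure R B 0 n) :=
          integral_mono (integrable_convMeasure 0 n _) (integrable_convMeasure 0 n _)
            fun x => by simpa only [norm_sub_rev (f x)] using hfg x y
      _ = g y := by simp
  calc _ ≤ ∑ v ∈ (freqMultiset R L n).toFinset, ∫ y, ‖G v y‖ ^ 2 ∂ν := by
        refine Finset.sum_le_sum fun v _ => ?_
        rw [heq]
        refine le_trans (pow_le_pow_left₀ (norm_nonneg _) (norm_integral_le_integral_norm _) 2) ?_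
        simp only [norm_mul, norm_star, norm_expFun, one_mul]
        exact sq_integral_le_integral_sq (hGm v)
    _ = ∫ y, ∑ v ∈ (freqMultiset R L n).toFinset, ‖G v y‖ ^ 2 ∂ν :=
        (integral_finsetSum _ fun v _ => (hGm v).integrable_sq).symm
    _ ≤ ∫ y, (∏ j ∈ Finset.range n, D j) * g y ∂ν :=
        integral_mono (integrable_finsetSum _ fun v _ => (hGm v).integrable_sq)
          (hg.const_mul _) hbd
    _ = _ := integral_const_mul _ _

/-- The coefficients of a sampled function are bounded below. -/
theorem IsFrameTower.le_sum_sampled (hT : IsFrameTower R B L C D) {c K δ : ℝ} (hδ : 0 ≤ δ)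
    (hcC : ∀ n, c ≤ ∏ j ∈ Finset.range n, C j) (hK0 : 0 < K)
    (hK : ∀ n, ∏ j ∈ Finset.range n, D j ≤ K) {n : ℕ}
    {ν : Measure (EuclideanSpace ℝ (Fin d))}
    (hν : ∀ v ∈ freqLevel R L n, δ ≤ ‖fourier ν (toReal v)‖ ^ 2)
    (f : EuclideanSpace ℝ (Fin d) → ℂ) :
    δ * (c / K) * ∫ x, ‖f x‖ ^ 2 ∂(convMeasure R B 0 n) ≤ ∑ v ∈ (freqMultiset R L n).toFinset,
      ‖(∫ x, star (expFun v x) * f x ∂(convMeasure R B 0 n)) * fourier ν (toReal v)‖ ^ 2 := by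
  have h1 := hT.analysis_lower n f
  rw [Finset.sum_multiset_map_count] at h1
  have hI : 0 ≤ ∫ x, ‖f x‖ ^ 2 ∂(convMeasure R B 0 n) :=
    integral_nonneg fun x => by positivity
  -- Multiplicities are at most K, so distinct frequencies carry at least a fraction 1/K of the sum.
  have h2 : c * ∫ x, ‖f x‖ ^ 2 ∂(convMeasure R B 0 n)
      ≤ K * ∑ v ∈ (freqMultiset R L n).toFinset,
        ‖∫ x, star (expFun v x) * f x ∂(convMeasure R B 0 n)‖ ^ 2 := by
    refine (mul_le_mul_of_nonneg_right (hcC n) hI).trans (h1.trans ?_)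
    rw [Finset.mul_sum]
    refine Finset.sum_le_sum fun v _ => ?_
    rw [nsmul_eq_mul]
    exact mul_le_mul_of_nonneg_right ((hT.count_le n v).trans (hK n)) (by positivity)
  have h3 : c / K * ∫ x, ‖f x‖ ^ 2 ∂(convMeasure R B 0 n)
      ≤ ∑ v ∈ (freqMultiset R L n).toFinset,
        ‖∫ x, star (expFun v x) * f x ∂(convMeasure R B 0 n)‖ ^ 2 := by
    rw [div_mul_eq_mul_div, div_le_iff₀ hK0, mul_comm _ K]
    exact h2
  rw [mul_assoc]
  refine (mul_le_mul_of_nonneg_left h3 hδ).trans ?_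
  rw [Finset.mul_sum]
  refine Finset.sum_le_sum fun v hv => ?_
  rw [norm_mul, mul_pow, mul_comm]
  exact mul_le_mul_of_nonneg_left
    (hν v ((mem_freqMultiset hT.zero_mem_freqs).1 (Multiset.mem_toFinset.1 hv))) (by positivity)

theorem sq_norm_le_two_mul_add {V : Type*} [SeminormedAddCommGroup V] (u v : V) :
    ‖u‖ ^ 2 ≤ 2 * ‖v‖ ^ 2 + 2 * ‖u - v‖ ^ 2 := by
  have h : ‖u‖ ≤ ‖v‖ + ‖u - v‖ := by
    simpa using norm_add_le v (u - v)
  nlinarith [sq_nonneg (‖v‖ - ‖u - v‖), norm_nonneg u, norm_nonneg v, norm_nonneg (u - v)]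

theorem IsFrameTower.summable_inner (hT : IsFrameTower R B L C D)
    (hμ : IsInfiniteConvolution R B μ) (x : Lp ℂ 2 (μ : Measure (EuclideanSpace ℝ (Fin d)))) :
    Summable fun v => ‖inner ℂ x (expFamily μ (freqSet R L) v)‖ ^ 2 := by
  obtain ⟨K, hK0, hK⟩ := hT.exists_upper
  exact summable_of_sum_le (fun _ => by positivity) (hT.sum_inner_expLp_le hμ hK0.le hK x)

/-- The lower frame bound on compactly supported continuous functions. -/
theorem IsFrameTower.le_tsum_inner_toLp (hT : IsFrameTower R B L C D)
    (hμ : IsInfiniteConvolution R B μ) (hδ : 0 < tailBound R B L) {c K : ℝ}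
    (hcC : ∀ n, c ≤ ∏ j ∈ Finset.range n, C j) (hK0 : 0 < K)
    (hK : ∀ n, ∏ j ∈ Finset.range n, D j ≤ K) {f : EuclideanSpace ℝ (Fin d) → ℂ}
    (hf : Continuous f) (hfs : HasCompactSupport f)
    (hfm : MemLp f 2 (μ : Measure (EuclideanSpace ℝ (Fin d)))) :
    tailBound R B L * (c / K) * ‖hfm.toLp f‖ ^ 2
      ≤ 2 * ∑' v, ‖inner ℂ (hfm.toLp f) (expFamily μ (freqSet R L) v)‖ ^ 2 := by
  classical
  have hB0 : ∀ j, (0 : Fin d → ℤ) ∈ B j := fun j => (hT.triple j).zero_mem_digits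
  choose ν hν1 hν2 using hμ.exists_tail hB0
  have hdirac := hμ.tendsto_dirac hT.digits_nonempty hν2
  obtain ⟨M, hM⟩ := hfs.exists_bound_of_continuous hf
  have huc := hfs.uniformContinuous_of_continuous hf
  set T := ∑' v, ‖inner ℂ (hfm.toLp f) (expFamily μ (freqSet R L) v)‖ ^ 2 with hTdef
  refine le_of_forall_pos_le_add fun ε hε => ?_
  -- The error enters as 2K ∫ g dν_n. As g is bounded and continuous with g(0) = ε/(2K), this tends
  -- to ε.
  obtain ⟨η, hη, hfg⟩ := norm_sub_sq_le_of_uniformContinuous hM huc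
    (ε := ε / (2 * K)) (by positivity)
  set g : EuclideanSpace ℝ (Fin d) → ℝ :=
    fun y => ε / (2 * K) + (2 * M) ^ 2 * min 1 (‖y‖ / η) with hg
  have hgc : Continuous g := by rw [hg]; fun_prop
  have hg0 : ∀ y, 0 ≤ g y := fun y => by rw [hg]; positivity
  have hgb : ∀ y, ‖g y‖ ≤ ε / (2 * K) + (2 * M) ^ 2 := fun y => by
    rw [Real.norm_of_nonneg (hg0 y)]
    have : (2 * M) ^ 2 * min 1 (‖y‖ / η) ≤ (2 * M) ^ 2 * 1 :=
      mul_le_mul_of_nonneg_left (min_le_left _ _) (by positivity)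
    simp only [hg]; linarith
  have hgi : ∀ n, Integrable g (ν n : Measure (EuclideanSpace ℝ (Fin d))) := fun n =>
    (integrable_const _).mono' hgc.aestronglyMeasurable (Eventually.of_forall hgb)
  have hlim1 : Tendsto (fun n => ∫ y, g y ∂(ν n : Measure (EuclideanSpace ℝ (Fin d)))) atTop
      (𝓝 (ε / (2 * K))) := by
    have := ProbabilityMeasure.tendsto_iff_forall_integral_tendsto.1 hdirac
      (BoundedContinuousFunction.ofNormedAddCommGroup g hgc _ hgb)
    have hval : ∫ y, g y ∂(diracProba (0 : EuclideanSpace ℝ (Fin d)) : Measure _)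
        = ε / (2 * K) := by
      change ∫ y, g y ∂(Measure.dirac 0) = _
      rw [integral_dirac]
      simp [hg]
    rw [← hval]
    exact this
  have hlim2 : Tendsto (fun n => ∫ x, ‖f x‖ ^ 2 ∂(convMeasure R B 0 n)) atTop
      (𝓝 (‖hfm.toLp f‖ ^ 2)) := by
    rw [norm_toLp_two_sq]
    refine hμ.tendsto_integral hT.digits_nonempty (hf.norm.pow 2) (K := M ^ 2) fun x => ?_
    rw [norm_pow, norm_norm]
    exact pow_le_pow_left₀ (norm_nonneg _) (hM x) 2
  have hinner : ∀ v : freqSet R L, inner ℂ (expFamily μ (freqSet R L) v) (hfm.toLp f)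
      = ∫ x, star (expFun v.1 x) * f x ∂(μ : Measure (EuclideanSpace ℝ (Fin d))) := fun v =>
    inner_toLp_toLp _ _
  have hstep : ∀ n ≥ 1, tailBound R B L * (c / K) * ∫ x, ‖f x‖ ^ 2 ∂(convMeasure R B 0 n)
      ≤ 2 * T + 2 * (K * ∫ y, g y ∂(ν n : Measure (EuclideanSpace ℝ (Fin d)))) := by
    intro n hn
    have hmem : ∀ v ∈ (freqMultiset R L n).toFinset, v ∈ freqSet R L := fun v hv =>
      freqLevel_subset_freqSet hn
        ((mem_freqMultiset hT.zero_mem_freqs).1 (Multiset.mem_toFinset.1 hv))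
    have h1 := hT.le_sum_sampled hδ.le hcC hK0 hK (n := n)
      (ν := (ν n : Measure (EuclideanSpace ℝ (Fin d)))) (fun v hv => by
        have := tailBound_le (B := B) hn hv
        rw [hν1] at this
        exact this) f
    have h2 := hT.sum_sub_le (hν2 n) hf hM (hgi n) hfg
    have h3 : ∑ v ∈ (freqMultiset R L n).toFinset,
        ‖∫ x, star (expFun v x) * f x ∂(μ : Measure (EuclideanSpace ℝ (Fin d)))‖ ^ 2 ≤ T := by
      have h4 := (hT.summable_inner hμ (hfm.toLp f)).sum_le_tsum
        ((freqMultiset R L n).toFinset.subtype (· ∈ freqSet R L)) fun _ _ => by positivity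
      refine le_trans (le_of_eq ?_) h4
      simp_rw [norm_inner_symm (hfm.toLp f), hinner]
      rw [Finset.sum_subtype_of_mem (fun v => ‖∫ x, star (expFun v x) * f x
        ∂(μ : Measure (EuclideanSpace ℝ (Fin d)))‖ ^ 2) hmem]
    have h5 : (∏ j ∈ Finset.range n, D j) * ∫ y, g y ∂(ν n : Measure (EuclideanSpace ℝ (Fin d)))
        ≤ K * ∫ y, g y ∂(ν n : Measure (EuclideanSpace ℝ (Fin d))) :=
      mul_le_mul_of_nonneg_right (hK n) (integral_nonneg hg0)
    refine h1.trans ((Finset.sum_le_sum fun v _ => sq_norm_le_two_mul_add _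
      (∫ x, star (expFun v x) * f x ∂(μ : Measure (EuclideanSpace ℝ (Fin d))))).trans ?_)
    rw [Finset.sum_add_distrib, ← Finset.mul_sum, ← Finset.mul_sum]
    linarith
  have hfin := le_of_tendsto_of_tendsto (hlim2.const_mul (tailBound R B L * (c / K)))
    (((hlim1.const_mul K).const_mul 2).const_add (2 * T))
    ((eventually_ge_atTop 1).mono hstep)
  refine hfin.trans_eq ?_
  field_simp

/-- The exponentials form a frame. -/
theorem IsFrameTower.isFrame (hT : IsFrameTower R B L C D)
    (hμ : IsInfiniteConvolution R B μ) (hδ : 0 < tailBound R B L) :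
    IsFrame (expFamily μ (freqSet R L)) := by
  obtain ⟨c, hc, hcC⟩ := hT.exists_lower
  obtain ⟨K, hK0, hK⟩ := hT.exists_upper
  set κ := tailBound R B L * (c / K) with hκ
  have hκ0 : 0 < κ := by positivity
  have hbessel : ∀ x, ∑' v, ‖inner ℂ x (expFamily μ (freqSet R L) v)‖ ^ 2 ≤ K * ‖x‖ ^ 2 :=
    fun x => (hT.summable_inner hμ x).tsum_le_of_sum_le (hT.sum_inner_expLp_le hμ hK0.le hK x)
  refine ⟨κ / 4, K, by positivity, hK0, fun x => ⟨hT.summable_inner hμ x, ?_, hbessel x⟩⟩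
  set T := ∑' v, ‖inner ℂ x (expFamily μ (freqSet R L) v)‖ ^ 2 with hTdef
  -- Perturbing x to F makes the inequality hold on a dense set: one factor 2 comes from the bound
  -- for F, another from splitting its coefficients. Closedness permits F = x, hence κ/4.
  have hclosed : IsClosed {F : Lp ℂ 2 (μ : Measure (EuclideanSpace ℝ (Fin d))) |
      κ * ‖F‖ ^ 2 ≤ 4 * T + 4 * (K * ‖F - x‖ ^ 2)} :=
    isClosed_le (by fun_prop) (by fun_prop)
  have hmem : x ∈ closure {F : Lp ℂ 2 (μ : Measure (EuclideanSpace ℝ (Fin d))) |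
      κ * ‖F‖ ^ 2 ≤ 4 * T + 4 * (K * ‖F - x‖ ^ 2)} := by
    rw [Metric.mem_closure_iff]
    intro ε hε
    obtain ⟨f, hfs, hfe, hfc, hfm⟩ := (Lp.memLp x).exists_hasCompactSupport_eLpNorm_sub_le
      (by simp) (ε := ENNReal.ofReal (ε / 2)) (by simpa using hε)
    refine ⟨hfm.toLp f, ?_, ?_⟩
    · have h1 := hT.le_tsum_inner_toLp hμ hδ hcC hK0 hK hfc hfs hfm
      have h2 : ∑' v, ‖inner ℂ (hfm.toLp f) (expFamily μ (freqSet R L) v)‖ ^ 2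
          ≤ 2 * T + 2 * ∑' v, ‖inner ℂ (hfm.toLp f - x) (expFamily μ (freqSet R L) v)‖ ^ 2 := by
        have hs1 := (hT.summable_inner hμ x).mul_left 2
        have hs2 := (hT.summable_inner hμ (hfm.toLp f - x)).mul_left 2
        rw [hTdef, ← tsum_mul_left, ← tsum_mul_left, ← hs1.tsum_add hs2]
        refine (hT.summable_inner hμ _).tsum_le_tsum (fun v => ?_) (hs1.add hs2)
        rw [inner_sub_left]
        exact sq_norm_le_two_mul_add _ _
      have h3 := hbessel (hfm.toLp f - x)
      rw [Set.mem_ofPred_eq]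
      linarith
    · have h1 := Lp.edist_toLp_toLp (⇑x) f (Lp.memLp x) hfm
      rw [Lp.toLp_coeFn] at h1
      rw [← edist_lt_ofReal, h1]
      exact hfe.trans_lt ((ENNReal.ofReal_lt_ofReal_iff hε).2 (half_lt_self hε))
  have hfin := hclosed.closure_subset hmem
  rw [Set.mem_ofPred_eq, sub_self, norm_zero] at hfin
  linarith

end Tower

/-! ### Removing a frequency from one level -/

/-- Finitely many vectors without a common orthogonal vector form a frame of a
finite-dimensional space. -/
theorem exists_frame_lower {ι H : Type*} [NormedAddCommGroup H] [InnerProductSpace ℂ H]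
    [FiniteDimensional ℂ H] {s : Finset ι} {f : ι → H}
    (hf : ∀ x : H, (∀ k ∈ s, inner ℂ (f k) x = 0) → x = 0) :
    ∃ c : ℝ, 0 < c ∧ ∀ x : H, c * ‖x‖ ^ 2 ≤ ∑ k ∈ s, ‖inner ℂ x (f k)‖ ^ 2 := by
  let T : H →ₗ[ℂ] EuclideanSpace ℂ s :=
    (WithLp.linearEquiv 2 ℂ (s → ℂ)).symm.toLinearMap ∘ₗ
      LinearMap.pi fun k => (innerSL ℂ (f k.1)).toLinearMap
  have hT : ∀ x k, T x k = inner ℂ (f k.1) x := fun x k => rfl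
  obtain ⟨K, hK0, hK⟩ := T.exists_antilipschitzWith (LinearMap.ker_eq_bot'.2 fun x hx =>
    hf x fun k hk => by rw [← hT x ⟨k, hk⟩, hx]; rfl)
  have hK0' : (0 : ℝ) < K := hK0
  refine ⟨((K : ℝ) ^ 2)⁻¹, by positivity, fun x => ?_⟩
  have h1 : ‖x‖ ≤ K * ‖T x‖ := by
    simpa using hK.le_mul_dist x 0
  have h2 : ‖T x‖ ^ 2 = ∑ k ∈ s, ‖inner ℂ x (f k)‖ ^ 2 := by
    rw [EuclideanSpace.norm_sq_eq, ← Finset.sum_coe_sort s]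
    refine Finset.sum_congr rfl fun k _ => ?_
    rw [hT, norm_inner_symm]
  rw [← h2, inv_mul_le_iff₀ (by positivity), ← mul_pow]
  exact pow_le_pow_left₀ (norm_nonneg _) h1 2

/-- A maximal independent subfamily has at most #B members and spans all the vectors, so some
frequency outside it can be dropped. -/
theorem IsFrameTriple.exists_erase {R : Matrix (Fin d) (Fin d) ℤ} {B L : Finset (Fin d → ℤ)}
    {C D : ℝ} (h : IsFrameTriple R B L C D) (hC : 0 < C) (hBL : B.card < L.card) :
    ∃ l ∈ L, l ≠ 0 ∧ ∃ C' : ℝ, 0 < C' ∧ IsFrameTriple R B (L.erase l) C' D := by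
  classical
  have he0 : expVector R B 0 ≠ 0 := by
    intro h0
    have h1 := congrFun (congrArg WithLp.ofLp h0) ⟨0, h.zero_mem_digits⟩
    rw [expVector_apply, expFun_zero_left] at h1
    have h2 := Real.sqrt_pos.2 h.card_pos
    simp at h1
    exact (Finset.ne_empty_of_mem h.zero_mem_digits) h1
  -- The subfamily is grown from the frequency 0, so that the dropped frequency is nonzero and 0
  -- survives.
  obtain ⟨b, hbL, h0b, hspan, hb⟩ := exists_linearIndepOn_extension (K := ℂ)
    (v := expVector R B) (s := {0}) (t := (L : Set (Fin d → ℤ)))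
    (by simpa using he0) (by simpa using h.zero_mem_freqs)
  have hbfin : b.Finite := L.finite_toSet.subset hbL
  have : Fintype b := hbfin.fintype
  have hcard : b.toFinset.card < L.card := by
    rw [Set.toFinset_card]
    refine lt_of_le_of_lt ?_ hBL
    simpa using hb.linearIndependent.fintype_card_le_finrank
  obtain ⟨l, hl, hlb⟩ := Finset.exists_mem_notMem_of_card_lt_card hcard
  rw [Set.mem_toFinset] at hlb
  have hl0 : l ≠ 0 := fun h => hlb (h ▸ h0b rfl)
  obtain ⟨c, hc, hcle⟩ := exists_frame_lower (s := L.erase l) (f := expVector R B) fun x hx => by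
    have h1 : ∀ y ∈ Submodule.span ℂ (expVector R B '' b), inner ℂ y x = 0 := by
      intro y hy
      induction hy using Submodule.span_induction with
      | mem y hy =>
        obtain ⟨k, hk, rfl⟩ := hy
        exact hx k (Finset.mem_erase.2 ⟨fun h => hlb (h ▸ hk), hbL hk⟩)
      | zero => simp
      | add y z _ _ hy hz => rw [inner_add_left, hy, hz, add_zero]
      | smul a y _ hy => rw [inner_smul_left, hy, mul_zero]
    have h2 : C * ‖x‖ ^ 2 ≤ 0 := by
      refine (h.lower x).trans_eq (Finset.sum_eq_zero fun k hk => ?_)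
      rw [norm_inner_symm, h1 _ (hspan ⟨k, hk, rfl⟩)]
      simp
    exact norm_eq_zero.1 (pow_eq_zero_iff two_ne_zero |>.1
      (le_antisymm (nonpos_of_mul_nonpos_right h2 hC) (by positivity)))
  -- The minimum with D keeps the lower bound below the upper one, as a triple requires.
  refine ⟨l, hl, hl0, min c D, lt_min hc (hC.trans_le h.le), h.expanding, h.zero_mem_digits,
    Finset.mem_erase.2 ⟨hl0.symm, h.zero_mem_freqs⟩, min_le_right _ _, fun x => ?_, fun x => ?_⟩
  · exact (mul_le_mul_of_nonneg_right (min_le_left _ _) (by positivity)).trans (hcle x)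
  · exact (Finset.sum_le_sum_of_subset_of_nonneg (Finset.erase_subset _ _)
      fun _ _ _ => by positivity).trans (h.upper x)

section Tower

variable {R : ℕ → Matrix (Fin d) (Fin d) ℤ} {B L L' : ℕ → Finset (Fin d → ℤ)} {C D : ℕ → ℝ}
  {μ : ProbabilityMeasure (EuclideanSpace ℝ (Fin d))}

theorem IsFrameTower.update (hT : IsFrameTower R B L C D) {J : ℕ} {s : Finset (Fin d → ℤ)} {c : ℝ}
    (hc : 0 < c) (hs : IsFrameTriple (R J) (B J) s c (D J)) :
    IsFrameTower R B (Function.update L J s) (Function.update C J c) D where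
  pos j := by
    rcases eq_or_ne j J with rfl | h
    · simpa using hc
    · simpa [h] using hT.pos j
  prod_lower := by
    obtain ⟨a, ha, h⟩ := hT.prod_lower
    refine ⟨c / C J * a, mul_pos (div_pos hc (hT.pos J)) ha, (h.const_mul _).congr' ?_⟩
    filter_upwards [eventually_gt_atTop J] with n hn
    rw [Finset.prod_update_of_mem (Finset.mem_range.2 hn),
      Finset.prod_eq_mul_prod_sdiff_singleton_of_mem (Finset.mem_range.2 hn) C]
    have := (hT.pos J).ne'
    field_simp
  prod_upper := hT.prod_upper
  triple j := by
    rcases eq_or_ne j J with rfl | h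
    · simpa using hs
    · simpa [h] using hT.triple j

theorem freqLevel_subset (hL : ∀ j, L' j ⊆ L j) (n : ℕ) : freqLevel R L' n ⊆ freqLevel R L n :=
  fun _ ⟨l, hl, hv⟩ => ⟨l, fun j => hL j (hl j), hv⟩

theorem freqSet_subset (hL : ∀ j, L' j ⊆ L j) : freqSet R L' ⊆ freqSet R L :=
  Set.iUnion₂_mono fun n _ => freqLevel_subset hL n

theorem tailBound_anti (hL : ∀ j, L' j ⊆ L j) (h0 : ∀ j, (0 : Fin d → ℤ) ∈ L' j) :
    tailBound R B L ≤ tailBound R B L' := by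
  -- The smaller set must be shown nonempty, since the real infimum of ∅ is 0; the frequency 0 at n
  -- = 1 supplies a member.
  refine csInf_le_csInf ⟨0, ?_⟩ ⟨_, 1, le_rfl, _, ⟨fun _ => 0, h0, rfl⟩, rfl⟩ ?_
  · rintro _ ⟨_, _, _, _, rfl⟩
    positivity
  · rintro _ ⟨n, hn, l, hl, rfl⟩
    exact ⟨n, hn, l, freqLevel_subset hL n hl, rfl⟩

/-- Padding by zeros brings sums of different lengths to a common length, where uniqueness of
representation applies. -/
theorem freqSum_truncate (l : ℕ → Fin d → ℤ) {n N : ℕ} (h : n ≤ N) :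
    freqSum R (fun j => if j < n then l j else 0) N = freqSum R l n := by
  rw [freqSum, freqSum, ← Finset.sum_subset (Finset.range_mono h)]
  · refine Finset.sum_congr rfl fun j hj => ?_
    rw [if_pos (Finset.mem_range.1 hj)]
  · intro j _ hj
    rw [if_neg (by simpa using hj), Matrix.mulVec_zero]

theorem freqSum_update (l : ℕ → Fin d → ℤ) {J n : ℕ} (hJ : J < n) (v : Fin d → ℤ) :
    freqSum R l n = freqSum R (Function.update l J v) n
      + (prodR R J).transpose.mulVec (l J - v) := by
  rw [freqSum, freqSum, ← Finset.add_sum_erase _ _ (Finset.mem_range.2 hJ),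
    ← Finset.add_sum_erase (Finset.range n)
      (fun j => (prodR R j).transpose.mulVec (Function.update l J v j)) (Finset.mem_range.2 hJ),
    Function.update_self, Matrix.mulVec_sub]
  have : ∑ j ∈ (Finset.range n).erase J, (prodR R j).transpose.mulVec (Function.update l J v j)
      = ∑ j ∈ (Finset.range n).erase J, (prodR R j).transpose.mulVec (l j) :=
    Finset.sum_congr rfl fun j hj => by rw [Function.update_of_ne (Finset.ne_of_mem_erase hj)]
  rw [this]
  abel

/-- Removing one nonzero frequency from one level removes infinitely many frequencies. -/
theorem infinite_freqSet_diff (h0 : ∀ j, (0 : Fin d → ℤ) ∈ L j) (hu : UniqueFreqSums R L)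
    (hinf : (freqSet R L).Infinite) {J : ℕ} {l₀ : Fin d → ℤ} (hl : l₀ ∈ L J) (hl0 : l₀ ≠ 0) :
    (freqSet R L \ freqSet R (Function.update L J ((L J).erase l₀))).Infinite := by
  set L' := Function.update L J ((L J).erase l₀) with hL'
  have hsub : ∀ j, L' j ⊆ L j := fun j => by
    rcases eq_or_ne j J with rfl | h
    · simpa [hL'] using Finset.erase_subset _ _
    · simp [hL', h]
  intro hfin
  -- Replacing the J-th digit l by l₀ moves an element of Λ into the removed set, so Λ is covered by
  -- finitely many translates of that set.
  refine hinf (((L J).finite_toSet.biUnion fun l _ =>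
    hfin.image fun v => v + (prodR R J).transpose.mulVec (l - l₀)).subset fun v hv => ?_)
  obtain ⟨n, -, hn⟩ := Set.mem_iUnion₂.1 hv
  obtain ⟨a, ha, rfl⟩ := freqLevel_mono h0 (le_max_left n (J + 1)) hn
  set N := max n (J + 1) with hN
  have hJN : J < N := le_max_right n (J + 1)
  have ha' : ∀ j, Function.update a J l₀ j ∈ L j := fun j => by
    rcases eq_or_ne j J with rfl | h
    · simpa using hl
    · simpa [h] using ha j
  refine Set.mem_biUnion (ha J) ⟨freqSum R (Function.update a J l₀) N, ⟨?_, ?_⟩,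
    (freqSum_update a hJN l₀).symm⟩
  · exact freqLevel_subset_freqSet (Nat.one_le_of_lt hJN) ⟨_, ha', rfl⟩
  · intro hmem
    obtain ⟨m, -, b, hb, hbeq⟩ := Set.mem_iUnion₂.1 hmem
    -- Uniqueness equates the J-th digits: l₀ must be b J, which avoids l₀, or a padded 0, which
    -- differs from l₀.
    have h := hu (max N m) (fun j => if j < N then Function.update a J l₀ j else 0)
      (fun j => if j < m then b j else 0)
      (fun j => by split_ifs <;> [exact ha' j; exact h0 j])
      (fun j => by split_ifs <;> [exact hsub j (hb j); exact h0 j])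
      (by rw [freqSum_truncate _ (le_max_left _ _), freqSum_truncate _ (le_max_right _ _), hbeq])
      J (hJN.trans_le (le_max_left _ _))
    simp only [hJN, if_true, Function.update_self] at h
    split_ifs at h with hJm
    · have := hb J
      simp [hL', ← h] at this
    · exact hl0 h

/-- The set removed is the part of Λ missed by the smaller tower. What remains is that tower's own
frequency set, and its tail bound is no smaller. -/
theorem IsFrameTower.exists_infinite_removable (hT : IsFrameTower R B L C D)
    (hμ : IsInfiniteConvolution R B μ) (hδ : 0 < tailBound R B L)
    (hBL : ∃ j, (B j).card < (L j).card) (hu : UniqueFreqSums R L)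
    (hinf : (freqSet R L).Infinite) :
    ∃ S ⊆ freqSet R L, S.Infinite ∧ IsFrame (expFamily μ (freqSet R L \ S)) := by
  obtain ⟨J, hJ⟩ := hBL
  obtain ⟨l, hl, hl0, c, hc, htr⟩ := (hT.triple J).exists_erase (hT.pos J) hJ
  have hT' := hT.update hc htr
  have hsub : ∀ j, Function.update L J ((L J).erase l) j ⊆ L j := fun j => by
    rcases eq_or_ne j J with rfl | h
    · simpa using Finset.erase_subset _ _
    · simp [h]
  refine ⟨_, Set.sdiff_subset, infinite_freqSet_diff hT.zero_mem_freqs hu hinf hl hl0, ?_⟩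
  rw [Set.sdiff_sdiff_cancel_left (freqSet_subset hsub)]
  exact hT'.isFrame hμ (hδ.trans_le (tailBound_anti hsub hT'.zero_mem_freqs))

end Tower

end FrameTower

/-! ### The main theorem

The no-overlap hypothesis is not used. The lower bound is obtained by sampling compactly supported
continuous functions at the points of the finite convolutions, since the tails tend to the unit mass
at `0`, and so it needs no step functions on the sets `p + K_n`. -/

theorem mainTheorem2 {d : ℕ} (R : ℕ → Matrix (Fin d) (Fin d) ℤ)
    (B L : ℕ → Finset (Fin d → ℤ)) (C D : ℕ → ℝ)
    (μ : ProbabilityMeasure (EuclideanSpace ℝ (Fin d)))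
    (hT : FrameTower.IsFrameTower R B L C D)
    (hμ : FrameTower.IsInfiniteConvolution R B μ)
    (hno : FrameTower.NoOverlap R B μ)
    (hδ : 0 < FrameTower.tailBound R B L) :
    ((∀ j, (B j).card = (L j).card) →
      FrameTower.IsRieszBasis (FrameTower.expFamily μ (FrameTower.freqSet R L))) ∧
    ((∃ j, (B j).card < (L j).card) →
      FrameTower.IsFrame (FrameTower.expFamily μ (FrameTower.freqSet R L)) ∧
      (FrameTower.UniqueFreqSums R L → (FrameTower.freqSet R L).Infinite →
        ∃ S ⊆ FrameTower.freqSet R L, S.Infinite ∧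
          FrameTower.IsFrame (FrameTower.expFamily μ (FrameTower.freqSet R L \ S)))) :=
  ⟨fun hBL => ⟨hT.isFrame hμ hδ, hT.isRieszSequence hμ hBL⟩,
    fun hBL => ⟨hT.isFrame hμ hδ, hT.exists_infinite_removable hμ hδ hBL⟩⟩
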